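/- **Model.** Let $n\ge 1$, $\mathcal X=\{x\in\mathbb R^n:\|x\|\le 1\}$ and $\tilde x=(x,1)\in\mathbb R^{n+1}$. Let $f(x)=\beta^{*\top}\tilde x$ be an unknown rule with $\|\beta^*\|\le 1$. At times $t=1,2,\dots$ a case $x_t\in\mathcal X$ arrives. If it is sent to court, a cost $c_t$ is paid and $y_t=f(x_t)+\eta_t$ is observed. The noises $\eta_t\sim\mathcal N(0,\sigma^2)$ are i.i.d. The costs $c_t$ are i.i.d. from an unknown distribution $P_c$ on $[c_{\min},c_{\max}]$, $c_{\min}\ge 0$, with mean $c_0$. Each of $\eta_t$ and $c_t$ is independent of the past, i.e. of $x_1,\dots,x_t$ and of the earlier noises and costs; $x_t$ may depend on earlier noises and costs. **Algorithm.** Let $D_{t-1}$ be the list of the pairs $(x_i,y_i)$, $i<t$, of the cases sent to court, and $X$ the matrix with rows $\tilde x_i^\top$ for these cases. Let $(\lambda_j,u_j)_{j\le n+1}$ be an orthonormal eigensystem of $X^\top X$, and set $$\bar q_t=X\sum_{j:\lambda_j\ge 1}\lambda_j^{-1}(u_j^\top\tilde x_t)\,u_j,\qquad \bar u_t=(u_j^\top\tilde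 x_t)_{j:\lambda_j<1}.$$ For a dataset $D$ let $\mathcal L(D)(x)=\hat\beta_D^\top\tilde x$, where $\hat\beta_D$ is a minimizer of $\sum_{(x,y)\in D}(y-\beta^\top\tilde x)^2$ over $\|\beta\|\le 1$. With thresholds $\alpha_1,\alpha_2>0$, the algorithm decides case $t$ itself, by $\mathcal L(D_{t-1})(x_t)$, if $\|\bar q_t\|\le\alpha_1$ and $\|\bar u_t\|\le\alpha_2$; otherwise it sends the case to court. **Claim.** There is an absolute $k\in\mathbb N$, and for each $\sigma\ge 0$ a constant $C>0$ depending only on $\sigma$, such that for all $n\ge1$, $T\ge0$, $\varepsilon>0$ and $\delta\in(0,1)$ there are thresholds $\alpha_1,\alpha_2>0$ depending only on $\sigma,n,T,\varepsilon,\delta$ for which the following holds. Put $\Lambda=1+\log\bigl(1+\tfrac{n(T+1)}{\varepsilon\delta}\bigr)$. Whatever the choice of minimizers $\hat\beta_D$, the rule $\beta^*$, the case process and the cost distribution, with probability at least $1-\delta$ all of the following hold simultaneously: 1. for every $t\ge 1$ such that case $t$ is not sent to court, $|\mathcal L(D_{t-1})(x_t)-f(x_t)|\le\varepsilon$; 2.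 for every $t\le T$ such that case $t$ is not sent to court, $|\mathcal L(D_{t-1})(x_t)-\mathcal L(D_{t-1}\cup\{(x_t,y_t)\})(x_t)|\le\varepsilon$, i.e. the prediction is within $\varepsilon$ of the decision that the court would have made; 3. the number of cases ever sent to court is at most $C\Lambda^k\, n^3/\varepsilon^4$; 4. the total cost of all cases ever sent to court is at most $C\Lambda^k\,\bigl(c_0\,n^3/\varepsilon^4+c_{\max}\bigr)$, which for a fixed cost distribution with $c_0>0$ is $\widetilde O(c_0\, n^3/\varepsilon^4)$ as $n^3/\varepsilon^4\to\infty$. -/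

import Mathlib

open MeasureTheory ProbabilityTheory

noncomputable section

/-- A dataset: the observations `(x, y)` of the cases brought to court so far, in order. -/
abbrev Dataset (n : ℕ) : Type := List (EuclideanSpace ℝ (Fin n) × ℝ)

/-- The feature vector `x` with a last coordinate `1` appended (for the constant offset). -/
def augment {n : ℕ} (x : EuclideanSpace ℝ (Fin n)) : EuclideanSpace ℝ (Fin (n + 1)) :=
  WithLp.toLp 2 (Fin.snoc (α := fun _ => ℝ) x.ofLp 1)

/-- The linear decision rule with coefficients `β` (the last one being the offset), at `x`. -/
def linearRule {n : ℕ} (β : EuclideanSpace ℝ (Fin (n + 1))) (x : EuclideanSpace ℝ (Fin n)) : ℝ :=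
  inner ℝ β (augment x)

/-- `β` is a least squares fit of `D` among the coefficient vectors of norm at most `1`. -/
def IsConstrainedLeastSquares {n : ℕ} (D : Dataset n) (β : EuclideanSpace ℝ (Fin (n + 1))) :
    Prop :=
  ‖β‖ ≤ 1 ∧ ∀ γ : EuclideanSpace ℝ (Fin (n + 1)), ‖γ‖ ≤ 1 →
    (D.map fun p => (p.2 - linearRule β p.1) ^ 2).sum ≤
      (D.map fun p => (p.2 - linearRule γ p.1) ^ 2).sum

/-- The data matrix `X`: its rows are the augmented feature vectors of the observed cases. -/
def dataMatrix {n : ℕ} (D : Dataset n) : Matrix (Fin D.length) (Fin (n + 1)) ℝ :=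
  Matrix.of fun i j => augment (D.get i).1 j

theorem gram_isHermitian {n : ℕ} (D : Dataset n) :
    ((dataMatrix D).transpose * dataMatrix D).IsHermitian := by
  simpa [Matrix.conjTranspose_eq_transpose_of_trivial] using
    Matrix.isHermitian_conjTranspose_mul_self (dataMatrix D)

/-- The eigenvalues `λ_j` of `Xᵀ X`. -/
def gramEigenvalue {n : ℕ} (D : Dataset n) (j : Fin (n + 1)) : ℝ :=
  (gram_isHermitian D).eigenvalues j

/-- An orthonormal basis of eigenvectors `u_j` of `Xᵀ X`. -/
def gramEigenvector {n : ℕ} (D : Dataset n) (j : Fin (n + 1)) : EuclideanSpace ℝ (Fin (n + 1)) :=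
  (gram_isHermitian D).eigenvectorBasis j

open Classical in
/-- The vector `q̄ = X Ū Λ̄⁻¹ Ūᵀ x`, where `Ū`, `Λ̄` collect the eigenpairs of `Xᵀ X` with
eigenvalue at least `1`. -/
def qBar {n : ℕ} (D : Dataset n) (x : EuclideanSpace ℝ (Fin n)) :
    EuclideanSpace ℝ (Fin D.length) :=
  WithLp.toLp 2 ((dataMatrix D).mulVec
    (∑ j with 1 ≤ gramEigenvalue D j,
      ((gramEigenvalue D j)⁻¹ * inner ℝ (gramEigenvector D j) (augment x)) •
        gramEigenvector D j).ofLp)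

/-- The vector `ū` of the coordinates `u_jᵀ x` of `x` along the eigenvectors of `Xᵀ X` with
eigenvalue less than `1`. -/
def uBar {n : ℕ} (D : Dataset n) (x : EuclideanSpace ℝ (Fin n)) :
    EuclideanSpace ℝ {j : Fin (n + 1) // gramEigenvalue D j < 1} :=
  WithLp.toLp 2 fun j => inner ℝ (gramEigenvector D j) (augment x)

/-- The KWIK selection rule with thresholds `a₁`, `a₂`: given the past dataset `D`, the case `x`
is decided by prediction iff `‖q̄‖ ≤ a₁` and `‖ū‖ ≤ a₂`; otherwise it is sent to court. -/
def SendsToCourt {n : ℕ} (a₁ a₂ : ℝ) (D : Dataset n) (x : EuclideanSpace ℝ (Fin n)) : Prop :=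
  ¬ (‖qBar D x‖ ≤ a₁ ∧ ‖uBar D x‖ ≤ a₂)

open Classical in
/-- The dataset available when case number `t` arrives (times are numbered from `0`), if the rule
with thresholds `a₁`, `a₂` is run on the cases `x 0, x 1, …`, where `y t` is the information that
a court proceeding on case `t` uncovers. -/
def kwikData {n : ℕ} (a₁ a₂ : ℝ) (x : ℕ → EuclideanSpace ℝ (Fin n)) (y : ℕ → ℝ) :
    ℕ → Dataset n
  | 0 => []
  | t + 1 =>
    if SendsToCourt a₁ a₂ (kwikData a₁ a₂ x y t) (x t) then
      kwikData a₁ a₂ x y t ++ [(x t, y t)]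
    else kwikData a₁ a₂ x y t

/-- Case `t` is sent to court in this run. -/
def KwikSends {n : ℕ} (a₁ a₂ : ℝ) (x : ℕ → EuclideanSpace ℝ (Fin n)) (y : ℕ → ℝ) (t : ℕ) :
    Prop :=
  SendsToCourt a₁ a₂ (kwikData a₁ a₂ x y t) (x t)

open Classical in
/-- The number of cases sent to court among the first `N`. -/
def kwikCount {n : ℕ} (a₁ a₂ : ℝ) (x : ℕ → EuclideanSpace ℝ (Fin n)) (y : ℕ → ℝ) (N : ℕ) : ℕ :=
  ((Finset.range N).filter (KwikSends a₁ a₂ x y)).card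

open Classical in
/-- The total cost of the cases sent to court among the first `N`, where `c t` is the cost of
bringing case `t` to court. -/
def kwikCost {n : ℕ} (a₁ a₂ : ℝ) (x : ℕ → EuclideanSpace ℝ (Fin n)) (y c : ℕ → ℝ) (N : ℕ) : ℝ :=
  ∑ t ∈ (Finset.range N).filter (KwikSends a₁ a₂ x y), c t

/-- The stochastic model. `ℱ t` is the information available when case `t` has arrived and neither
its noise `η t` nor its cost `c t` has been revealed. The case `x t` may depend in any way on the
past. Each `η t` is `N(0, σ²)` and independent of the past, and each `c t` has law `P` and is
independent of the past; since earlier noises and costs belong to the past, the noises are i.i.d.,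
and so are the costs. -/
structure IsCourtProcess {n : ℕ} {Ω : Type*} {mΩ : MeasurableSpace Ω} (μ : Measure Ω)
    (σ : NNReal) (P : Measure ℝ) (ℱ : Filtration ℕ mΩ)
    (x : ℕ → Ω → EuclideanSpace ℝ (Fin n)) (η c : ℕ → Ω → ℝ) : Prop where
  case_measurable : ∀ t, Measurable[ℱ t] (x t)
  case_norm_le : ∀ t ω, ‖x t ω‖ ≤ 1
  noise_measurable : ∀ t, Measurable[ℱ (t + 1)] (η t)
  noise_law : ∀ t, μ.map (η t) = gaussianReal 0 (σ ^ 2)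
  noise_indep : ∀ t, Indep (MeasurableSpace.comap (η t) inferInstance) (ℱ t) μ
  cost_measurable : ∀ t, Measurable[ℱ (t + 1)] (c t)
  cost_law : ∀ t, μ.map (c t) = P
  cost_indep : ∀ t, Indep (MeasurableSpace.comap (c t) inferInstance) (ℱ t) μ

/-- The logarithm whose powers the soft-O notation hides. -/
def logFactor (n T : ℕ) (ε δ : ℝ) : ℝ := 1 + Real.log (1 + n * (T + 1) / (ε * δ))

end

/-! Let V be the ridge matrix `1 + Xᵀ X`, S the self-normalized score of the true rule, and a the
common value of both thresholds.

Few cases go to court: a case violating a threshold has leverage at least a²/2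
(`SendsToCourt.le_leverage`), so it multiplies det V by at least 1 + a²/2 (`kwikCount_mul_log_le`).
Since log det V grows only logarithmically in the number of observations (`log_det_ridge_le`), that
number is of order nΛ/a², with the implicit inequality resolved in `log_det_le_of_potential`.

Predictions are accurate: a case satisfying both thresholds lies in well-explored directions, so its
error is at most a(√Q + 2), where Q is the in-sample squared error (`abs_linearRule_sub_le`).
Minimality of the fit gives Q ≤ 4S + 4. The process exp(S/(2r) - log det V / 2), with r the variance
proxy, is a supermartingale, because Gaussian noise makes each factor integrate to at most 1;
Ville's inequality then bounds S by order nΛ at all times at once. Choosing a proportional to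
ε/√(nΛ) makes the error ε/2 and the court count of order n²Λ²/ε², which is within the claimed n³/ε⁴
when ε < 3.

The court's own decision refits with one more point, which raises S by at most η_t²; a union bound
over t < T controls this. Costs are handled by a second exponential supermartingale: whether a case
is sent is decided before its cost is revealed. For ε ≥ 3 no case needs to go to court. -/

section LeastSquares

open Matrix

/-! ### Rank-one updates of a positive definite matrix -/

section RankOne

theorem Matrix.PosDef.add_vecMulVec_self {d : Type*} [Fintype d] {V : Matrix d d ℝ} (hV : V.PosDef) (z : d → ℝ) :
    (V + vecMulVec z z).PosDef := by
  refine hV.add_posSemidef ?_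
  simpa using posSemidef_vecMulVec_self_star z

variable {d : Type*} [Fintype d] [DecidableEq d]

theorem det_add_vecMulVec_self {V : Matrix d d ℝ} (hV : V.PosDef) (z : d → ℝ) :
    (V + vecMulVec z z).det = V.det * (1 + z ⬝ᵥ V⁻¹ *ᵥ z) := by
  have h := det_add_replicateCol_mul_replicateRow (A := V) (ι := Unit) ((isUnit_iff_isUnit_det _).1 hV.isUnit) z z
  rw [← vecMulVec_eq] at h
  rw [h, det_unique (n := Unit), Matrix.mul_assoc]
  congr 2

theorem Matrix.PosDef.dotProduct_inv_mulVec_nonneg {V : Matrix d d ℝ} (hV : V.PosDef)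
    (z : d → ℝ) : 0 ≤ z ⬝ᵥ V⁻¹ *ᵥ z := by
  simpa using hV.inv.posSemidef.dotProduct_mulVec_nonneg z

theorem Matrix.PosDef.dotProduct_inv_mulVec_comm {V : Matrix d d ℝ} (hV : V.PosDef)
    (z s : d → ℝ) : s ⬝ᵥ V⁻¹ *ᵥ z = z ⬝ᵥ V⁻¹ *ᵥ s := by
  have h : V⁻¹ᵀ = V⁻¹ := by simpa using hV.inv.isHermitian.eq
  rw [dotProduct_comm, dotProduct_mulVec z, ← mulVec_transpose, h]

/-- The change of the quadratic form of the inverse under a rank one update. -/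
theorem Matrix.PosDef.quadratic_inv_update {V : Matrix d d ℝ} (hV : V.PosDef) (z s : d → ℝ)
    (e : ℝ) :
    (s + e • z) ⬝ᵥ (V + vecMulVec z z)⁻¹ *ᵥ (s + e • z) =
      s ⬝ᵥ V⁻¹ *ᵥ s + (2 * e * (z ⬝ᵥ V⁻¹ *ᵥ s) + e ^ 2 * (z ⬝ᵥ V⁻¹ *ᵥ z) -
        (z ⬝ᵥ V⁻¹ *ᵥ s) ^ 2) / (1 + z ⬝ᵥ V⁻¹ *ᵥ z) := by
  have hw := hV.dotProduct_inv_mulVec_nonneg z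
  have hc := hV.dotProduct_inv_mulVec_comm z s
  set w := z ⬝ᵥ V⁻¹ *ᵥ z with hwdef
  set a := z ⬝ᵥ V⁻¹ *ᵥ s with hadef
  -- V⁻¹s + kV⁻¹z solves the updated linear system exactly for this k, which replaces the
  -- Sherman–Morrison formula.
  set k := (e - a) / (1 + w) with hk
  have hkw : k * (1 + w) = e - a := by rw [hk]; field_simp
  have hcancel : ∀ v : d → ℝ, V *ᵥ V⁻¹ *ᵥ v = v := fun v => by
    rw [mulVec_mulVec, mul_nonsing_inv _ ((isUnit_iff_isUnit_det _).1 hV.isUnit), one_mulVec]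
  have hsol : s + e • z = (V + vecMulVec z z) *ᵥ (V⁻¹ *ᵥ s + k • V⁻¹ *ᵥ z) := by
    rw [add_mulVec, mulVec_add, mulVec_smul, hcancel, hcancel, vecMulVec_mulVec, dotProduct_add,
      dotProduct_smul, ← hwdef, ← hadef]
    ext i
    simp only [Pi.add_apply, Pi.smul_apply, smul_eq_mul, MulOpposite.smul_eq_mul_unop,
      MulOpposite.unop_op]
    linear_combination (-z i) * hkw
  have hinv : (V + vecMulVec z z)⁻¹ *ᵥ (s + e • z) = V⁻¹ *ᵥ s + k • V⁻¹ *ᵥ z := by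
    conv_lhs => rw [hsol]
    rw [mulVec_mulVec, nonsing_inv_mul _ ((isUnit_iff_isUnit_det _).1 (hV.add_vecMulVec_self z).isUnit), one_mulVec]
  rw [hinv, add_dotProduct, dotProduct_add, dotProduct_add, smul_dotProduct, smul_dotProduct,
    dotProduct_smul, dotProduct_smul, ← hwdef, ← hadef, hc]
  simp only [smul_eq_mul]
  have h1 : (1 + w) ≠ 0 := by positivity
  rw [hk]
  field_simp
  ring

theorem Matrix.PosDef.quadratic_inv_update_le {V : Matrix d d ℝ} (hV : V.PosDef) (z s : d → ℝ)
    (e : ℝ) :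
    (s + e • z) ⬝ᵥ (V + vecMulVec z z)⁻¹ *ᵥ (s + e • z) ≤ s ⬝ᵥ V⁻¹ *ᵥ s + e ^ 2 := by
  have hw := hV.dotProduct_inv_mulVec_nonneg z
  rw [hV.quadratic_inv_update]
  gcongr
  rw [div_le_iff₀ (by positivity)]
  -- After clearing 1 + w, the gap is exactly the square (e - zᵀV⁻¹s)².
  nlinarith [sq_nonneg (e - z ⬝ᵥ V⁻¹ *ᵥ s)]

/-- Young's inequality by completing the square at 2V⁻¹s. The weight 1/2 lets the fit's own
quadratic form absorb the last term. -/
theorem Matrix.PosDef.two_mul_dotProduct_le {V : Matrix d d ℝ} (hV : V.PosDef) (s v : d → ℝ) :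
    2 * (s ⬝ᵥ v) ≤ 2 * (s ⬝ᵥ V⁻¹ *ᵥ s) + (v ⬝ᵥ V *ᵥ v) / 2 := by
  have hcancel : ∀ v : d → ℝ, V *ᵥ V⁻¹ *ᵥ v = v := fun v => by
    rw [mulVec_mulVec, mul_nonsing_inv _ ((isUnit_iff_isUnit_det _).1 hV.isUnit), one_mulVec]
  have hT : Vᵀ = V := by simpa using hV.isHermitian.eq
  have h0 : 0 ≤ (v - (2 : ℝ) • V⁻¹ *ᵥ s) ⬝ᵥ V *ᵥ (v - (2 : ℝ) • V⁻¹ *ᵥ s) := by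
    simpa using hV.posSemidef.dotProduct_mulVec_nonneg (v - (2 : ℝ) • V⁻¹ *ᵥ s)
  have h1 : (V⁻¹ *ᵥ s) ⬝ᵥ V *ᵥ v = s ⬝ᵥ v := by
    rw [dotProduct_mulVec, ← mulVec_transpose, hT, hcancel]
  rw [mulVec_sub, mulVec_smul, hcancel, sub_dotProduct, dotProduct_sub, dotProduct_sub,
    smul_dotProduct, smul_dotProduct, dotProduct_smul, dotProduct_smul, h1,
    dotProduct_comm v s, dotProduct_comm (V⁻¹ *ᵥ s) s] at h0
  simp only [smul_eq_mul] at h0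
  linarith

/-- Each eigenvalue is at most the trace. This is cruder than AM-GM, but only the logarithm of the
bound matters. -/
theorem Matrix.PosDef.det_le_trace_pow {V : Matrix d d ℝ} (hV : V.PosDef) :
    V.det ≤ V.trace ^ Fintype.card d := by
  rw [hV.isHermitian.det_eq_prod_eigenvalues, hV.isHermitian.trace_eq_sum_eigenvalues,
    ← Finset.card_univ]
  rw [← Finset.prod_const]
  refine Finset.prod_le_prod (fun j _ => (hV.eigenvalues_pos j).le) fun j hj => ?_
  exact Finset.single_le_sum (f := fun i => (hV.isHermitian.eigenvalues i : ℝ))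
    (fun i _ => (hV.eigenvalues_pos i).le) hj

end RankOne

/-! ### Ridge matrix, score and constrained least squares -/

variable {n : ℕ}

theorem linearRule_eq_dotProduct (β : EuclideanSpace ℝ (Fin (n + 1)))
    (x : EuclideanSpace ℝ (Fin n)) :
    linearRule β x = β.ofLp ⬝ᵥ (augment x).ofLp := by
  rw [linearRule, EuclideanSpace.inner_eq_star_dotProduct, dotProduct_comm]
  simp

theorem norm_augment_sq (x : EuclideanSpace ℝ (Fin n)) : ‖augment x‖ ^ 2 = ‖x‖ ^ 2 + 1 := by
  rw [EuclideanSpace.norm_sq_eq, EuclideanSpace.norm_sq_eq, Fin.sum_univ_castSucc]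
  simp [augment]

/-- The Gram matrix `Xᵀ X`. -/
def gramMatrix (D : Dataset n) : Matrix (Fin (n + 1)) (Fin (n + 1)) ℝ :=
  (dataMatrix D)ᵀ * dataMatrix D

theorem gram_apply (D : Dataset n) (i j : Fin (n + 1)) :
    gramMatrix D i j = (D.map fun p => augment p.1 i * augment p.1 j).sum := by
  rw [gramMatrix, Matrix.mul_apply, ← Fin.sum_univ_fun_getElem]
  rfl

@[simp] theorem gram_nil : gramMatrix ([] : Dataset n) = 0 := by
  ext i j; simp [gram_apply]

theorem gram_append (D : Dataset n) (x : EuclideanSpace ℝ (Fin n)) (y : ℝ) :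
    gramMatrix (D ++ [(x, y)]) = gramMatrix D + vecMulVec (augment x).ofLp (augment x).ofLp := by
  ext i j; simp [gram_apply, vecMulVec_apply]

theorem gram_posSemidef (D : Dataset n) : (gramMatrix D).PosSemidef := by
  simpa [gramMatrix] using posSemidef_conjTranspose_mul_self (dataMatrix D)

/-- The regularized Gram matrix `1 + Xᵀ X`. -/
def ridge (D : Dataset n) : Matrix (Fin (n + 1)) (Fin (n + 1)) ℝ := 1 + gramMatrix D

@[simp] theorem ridge_nil : ridge ([] : Dataset n) = 1 := by simp [ridge]

theorem ridge_posDef (D : Dataset n) : (ridge D).PosDef :=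
  PosDef.one.add_posSemidef (gram_posSemidef D)

theorem ridge_append (D : Dataset n) (x : EuclideanSpace ℝ (Fin n)) (y : ℝ) :
    ridge (D ++ [(x, y)]) = ridge D + vecMulVec (augment x).ofLp (augment x).ofLp := by
  rw [ridge, gram_append, ridge, add_assoc]

/-- The noise-weighted sum of the feature vectors, `Xᵀ (y - X β)`. -/
noncomputable def score (β : EuclideanSpace ℝ (Fin (n + 1))) (D : Dataset n) : Fin (n + 1) → ℝ :=
  (D.map fun p => (p.2 - linearRule β p.1) • (augment p.1).ofLp).sum

@[simp] theorem score_nil (β : EuclideanSpace ℝ (Fin (n + 1))) : score β [] = 0 := rfl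

theorem score_append (β : EuclideanSpace ℝ (Fin (n + 1))) (D : Dataset n)
    (x : EuclideanSpace ℝ (Fin n)) (y : ℝ) :
    score β (D ++ [(x, y)]) = score β D + (y - linearRule β x) • (augment x).ofLp := by
  simp [score]

/-- The self-normalized norm of the score. -/
noncomputable def scoreNormSq (β : EuclideanSpace ℝ (Fin (n + 1))) (D : Dataset n) : ℝ :=
  score β D ⬝ᵥ (ridge D)⁻¹ *ᵥ score β D

/-- The leverage `x̃ᵀ (1 + Xᵀ X)⁻¹ x̃`. -/
noncomputable def leverage (D : Dataset n) (x : EuclideanSpace ℝ (Fin n)) : ℝ :=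
  (augment x).ofLp ⬝ᵥ (ridge D)⁻¹ *ᵥ (augment x).ofLp

/-- The prediction error of the ridge regression at `x`. -/
noncomputable def ridgeError (β : EuclideanSpace ℝ (Fin (n + 1))) (D : Dataset n)
    (x : EuclideanSpace ℝ (Fin n)) : ℝ :=
  (augment x).ofLp ⬝ᵥ (ridge D)⁻¹ *ᵥ score β D

theorem leverage_nonneg (D : Dataset n) (x : EuclideanSpace ℝ (Fin n)) : 0 ≤ leverage D x :=
  (ridge_posDef D).dotProduct_inv_mulVec_nonneg _

theorem det_ridge_append (D : Dataset n) (x : EuclideanSpace ℝ (Fin n)) (y : ℝ) :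
    (ridge (D ++ [(x, y)])).det = (ridge D).det * (1 + leverage D x) := by
  rw [ridge_append, det_add_vecMulVec_self (ridge_posDef D), leverage]

theorem scoreNormSq_append (β : EuclideanSpace ℝ (Fin (n + 1))) (D : Dataset n)
    (x : EuclideanSpace ℝ (Fin n)) (y : ℝ) :
    scoreNormSq β (D ++ [(x, y)]) = scoreNormSq β D +
      (2 * (y - linearRule β x) * ridgeError β D x + (y - linearRule β x) ^ 2 * leverage D x -
        ridgeError β D x ^ 2) / (1 + leverage D x) := by
  rw [scoreNormSq, score_append, ridge_append, (ridge_posDef D).quadratic_inv_update]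
  rfl

/-- Needed for the hypothetical fit that includes the current case: its price is one squared noise.
-/
theorem scoreNormSq_append_le (β : EuclideanSpace ℝ (Fin (n + 1))) (D : Dataset n)
    (x : EuclideanSpace ℝ (Fin n)) (y : ℝ) :
    scoreNormSq β (D ++ [(x, y)]) ≤ scoreNormSq β D + (y - linearRule β x) ^ 2 := by
  rw [scoreNormSq, score_append, ridge_append]
  exact (ridge_posDef D).quadratic_inv_update_le _ _ _

theorem trace_ridge_le (D : Dataset n) (hD : ∀ p ∈ D, ‖p.1‖ ≤ 1) :
    (ridge D).trace ≤ n + 1 + 2 * D.length := by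
  induction D using List.reverseRecOn with
  | nil => simp
  | append_singleton D p ih =>
    have h1 := ih fun q hq => hD q (by simp [hq])
    have h2 : ‖p.1‖ ≤ 1 := hD p (by simp)
    have h3 := norm_augment_sq p.1
    rw [EuclideanSpace.norm_sq_eq] at h3
    rw [show p = (p.1, p.2) from rfl, ridge_append, trace_add, trace_vecMulVec]
    have h4 : (augment p.1).ofLp ⬝ᵥ (augment p.1).ofLp ≤ 2 := by
      simp only [Real.norm_eq_abs, sq_abs] at h3
      simp only [dotProduct, ← sq, h3]
      nlinarith [norm_nonneg p.1]
    simp only [List.length_append, List.length_singleton]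
    push_cast
    linarith

theorem log_det_ridge_le (D : Dataset n) (hD : ∀ p ∈ D, ‖p.1‖ ≤ 1) :
    Real.log (ridge D).det ≤ (n + 1) * Real.log (n + 1 + 2 * D.length) := by
  have h0 := (ridge_posDef D).det_pos
  have h1 := (ridge_posDef D).det_le_trace_pow
  have h2 : 0 ≤ (ridge D).trace := (ridge_posDef D).posSemidef.trace_nonneg
  have h3 := h1.trans (pow_le_pow_left₀ h2 (trace_ridge_le D hD) _)
  have h4 := Real.log_le_log h0 h3
  rw [Real.log_pow] at h4
  simpa using h4

theorem dotProduct_gram_mulVec (D : Dataset n) (v : Fin (n + 1) → ℝ) :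
    v ⬝ᵥ gramMatrix D *ᵥ v = (D.map fun p => (v ⬝ᵥ (augment p.1).ofLp) ^ 2).sum := by
  induction D using List.reverseRecOn with
  | nil => simp
  | append_singleton D p ih =>
    rw [show p = (p.1, p.2) from rfl, gram_append, add_mulVec, dotProduct_add, ih,
      vecMulVec_mulVec]
    simp [dotProduct_comm (augment p.1).ofLp v, sq]

theorem score_dotProduct (β : EuclideanSpace ℝ (Fin (n + 1))) (D : Dataset n)
    (v : Fin (n + 1) → ℝ) :
    score β D ⬝ᵥ v =
      (D.map fun p => (p.2 - linearRule β p.1) * (v ⬝ᵥ (augment p.1).ofLp)).sum := by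
  induction D using List.reverseRecOn with
  | nil => simp
  | append_singleton D p ih =>
    rw [show p = (p.1, p.2) from rfl, score_append, add_dotProduct, ih, smul_dotProduct]
    simp [dotProduct_comm (augment p.1).ofLp v]

theorem linearRule_sub (β γ : EuclideanSpace ℝ (Fin (n + 1))) (x : EuclideanSpace ℝ (Fin n)) :
    linearRule β x - linearRule γ x = (β - γ).ofLp ⬝ᵥ (augment x).ofLp := by
  simp [linearRule_eq_dotProduct]

/-- The loss is quadratic, so its expansion around β is exact; the linear term carries the noise
through the score. -/
theorem sum_sq_residual_eq (β b : EuclideanSpace ℝ (Fin (n + 1))) (D : Dataset n) :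
    (D.map fun p => (p.2 - linearRule b p.1) ^ 2).sum =
      (D.map fun p => (p.2 - linearRule β p.1) ^ 2).sum -
        2 * (score β D ⬝ᵥ (b - β).ofLp) + (b - β).ofLp ⬝ᵥ gramMatrix D *ᵥ (b - β).ofLp := by
  rw [score_dotProduct, dotProduct_gram_mulVec, ← List.sum_map_mul_left]
  induction D with
  | nil => simp
  | cons p D ih =>
    simp only [List.map_cons, List.sum_cons, ih, ← linearRule_sub]
    ring

/-- The in-sample error of the constrained least squares fit. -/
theorem IsConstrainedLeastSquares.error_le {D : Dataset n}
    {b β : EuclideanSpace ℝ (Fin (n + 1))} (hb : IsConstrainedLeastSquares D b) (hβ : ‖β‖ ≤ 1) :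
    (b - β).ofLp ⬝ᵥ gramMatrix D *ᵥ (b - β).ofLp ≤ 4 * scoreNormSq β D + 4 := by
  have h1 := hb.2 β hβ
  rw [sum_sq_residual_eq β b] at h1
  -- Minimality bounds the Gram form by twice the pairing with the score. Half of that form is
  -- absorbed on the left, and the identity part of the ridge matrix costs ‖b - β‖² ≤ 4 by the norm
  -- constraint.
  have h2 := (ridge_posDef D).two_mul_dotProduct_le (score β D) (b - β).ofLp
  have h3 : (b - β).ofLp ⬝ᵥ (b - β).ofLp = ‖b - β‖ ^ 2 := by
    rw [EuclideanSpace.norm_sq_eq]; simp [dotProduct, sq]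
  have h4 : ‖b - β‖ ≤ 2 := (norm_sub_le _ _).trans (by linarith [hb.1])
  rw [ridge, add_mulVec, one_mulVec, dotProduct_add, h3, ← ridge] at h2
  have h5 : ‖b - β‖ ^ 2 ≤ 4 := by nlinarith [norm_nonneg (b - β)]
  simp only [scoreNormSq]
  linarith

end LeastSquares

/-! ### Eigenbasis formulas for the selection rule -/

section Spectral

open Matrix

variable {n : ℕ}

theorem gram_mulVec_eigenvector (D : Dataset n) (j : Fin (n + 1)) :
    gramMatrix D *ᵥ (gramEigenvector D j).ofLp =
      gramEigenvalue D j • (gramEigenvector D j).ofLp :=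
  (gram_isHermitian D).mulVec_eigenvectorBasis j

theorem gramEigenvalue_nonneg (D : Dataset n) (j : Fin (n + 1)) : 0 ≤ gramEigenvalue D j :=
  (gram_posSemidef D).eigenvalues_nonneg j

theorem dotProduct_eq_sum_eigenvector (D : Dataset n) (v w : EuclideanSpace ℝ (Fin (n + 1))) :
    v.ofLp ⬝ᵥ w.ofLp =
      ∑ j, inner ℝ (gramEigenvector D j) v * inner ℝ (gramEigenvector D j) w := by
  have h := (gram_isHermitian D).eigenvectorBasis.sum_inner_mul_inner v w
  have h2 : inner ℝ v w = v.ofLp ⬝ᵥ w.ofLp := by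
    rw [EuclideanSpace.inner_eq_star_dotProduct, dotProduct_comm]; simp
  rw [← h2, ← h]
  exact Finset.sum_congr rfl fun j _ => by rw [real_inner_comm]; rfl

theorem mulVec_eq_sum_eigenvector {D : Dataset n} {A : Matrix (Fin (n + 1)) (Fin (n + 1)) ℝ}
    {f : ℝ → ℝ}
    (hA : ∀ j, A *ᵥ (gramEigenvector D j).ofLp =
      f (gramEigenvalue D j) • (gramEigenvector D j).ofLp)
    (w : EuclideanSpace ℝ (Fin (n + 1))) :
    A *ᵥ w.ofLp = ∑ j, (f (gramEigenvalue D j) * inner ℝ (gramEigenvector D j) w) •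
      (gramEigenvector D j).ofLp := by
  have h : w = ∑ j, inner ℝ (gramEigenvector D j) w • gramEigenvector D j :=
    ((gram_isHermitian D).eigenvectorBasis.sum_repr' w).symm
  have h' : w.ofLp = ∑ j, inner ℝ (gramEigenvector D j) w • (gramEigenvector D j).ofLp := by
    conv_lhs => rw [h]
    simp
  conv_lhs => rw [h']
  rw [mulVec_sum]
  exact Finset.sum_congr rfl fun j _ => by rw [mulVec_smul, hA, smul_smul, mul_comm]

theorem inner_eigenvector (D : Dataset n) (v : EuclideanSpace ℝ (Fin (n + 1)))
    (j : Fin (n + 1)) :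
    v.ofLp ⬝ᵥ (gramEigenvector D j).ofLp = inner ℝ (gramEigenvector D j) v := by
  rw [EuclideanSpace.inner_eq_star_dotProduct]; simp

/-- The quadratic form of a function of the Gram matrix in its eigenbasis. -/
theorem quadratic_eq_sum_eigenvector {D : Dataset n} {A : Matrix (Fin (n + 1)) (Fin (n + 1)) ℝ}
    {f : ℝ → ℝ}
    (hA : ∀ j, A *ᵥ (gramEigenvector D j).ofLp =
      f (gramEigenvalue D j) • (gramEigenvector D j).ofLp)
    (v : EuclideanSpace ℝ (Fin (n + 1))) :
    v.ofLp ⬝ᵥ A *ᵥ v.ofLp =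
      ∑ j, f (gramEigenvalue D j) * inner ℝ (gramEigenvector D j) v ^ 2 := by
  rw [mulVec_eq_sum_eigenvector hA, dotProduct_sum]
  refine Finset.sum_congr rfl fun j _ => ?_
  rw [dotProduct_smul, inner_eigenvector, smul_eq_mul]
  ring

open Classical in
theorem norm_uBar_sq (D : Dataset n) (x : EuclideanSpace ℝ (Fin n)) :
    ‖uBar D x‖ ^ 2 = ∑ j, (if 1 ≤ gramEigenvalue D j then 0 else 1) *
      inner ℝ (gramEigenvector D j) (augment x) ^ 2 := by
  rw [EuclideanSpace.norm_sq_eq]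
  simp only [uBar, Real.norm_eq_abs, sq_abs, ite_mul, zero_mul, one_mul]
  rw [Finset.sum_congr rfl fun j _ => show (if 1 ≤ gramEigenvalue D j then (0 : ℝ) else
    inner ℝ (gramEigenvector D j) (augment x) ^ 2) = if gramEigenvalue D j < 1 then
      inner ℝ (gramEigenvector D j) (augment x) ^ 2 else 0 by simp only [← not_lt, ite_not],
    ← Finset.sum_filter]
  exact (Finset.sum_subtype _ (by simp)
    fun j => inner ℝ (gramEigenvector D j) (augment x) ^ 2).symm

open Classical in
theorem norm_qBar_sq (D : Dataset n) (x : EuclideanSpace ℝ (Fin n)) :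
    ‖qBar D x‖ ^ 2 = ∑ j, (if 1 ≤ gramEigenvalue D j then (gramEigenvalue D j)⁻¹ else 0) *
      inner ℝ (gramEigenvector D j) (augment x) ^ 2 := by
  set w : EuclideanSpace ℝ (Fin (n + 1)) := ∑ j with 1 ≤ gramEigenvalue D j,
      ((gramEigenvalue D j)⁻¹ * inner ℝ (gramEigenvector D j) (augment x)) •
        gramEigenvector D j with hw
  have h1 : ‖qBar D x‖ ^ 2 = w.ofLp ⬝ᵥ gramMatrix D *ᵥ w.ofLp := by
    rw [EuclideanSpace.norm_sq_eq, gramMatrix, ← mulVec_mulVec, dotProduct_mulVec,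
      vecMul_transpose]
    simp [qBar, dotProduct, sq, ← hw]
  rw [h1, quadratic_eq_sum_eigenvector (f := id) (fun j => gram_mulVec_eigenvector D j)]
  refine Finset.sum_congr rfl fun j _ => ?_
  have h2 : inner ℝ (gramEigenvector D j) w = if 1 ≤ gramEigenvalue D j then
      (gramEigenvalue D j)⁻¹ * inner ℝ (gramEigenvector D j) (augment x) else 0 := by
    have hon := (gram_isHermitian D).eigenvectorBasis.orthonormal
    rw [hw, inner_sum]
    simp only [inner_smul_right]
    rw [Finset.sum_filter]
    rw [Finset.sum_eq_single j]
    · have : inner ℝ (gramEigenvector D j) (gramEigenvector D j) = 1 := by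
        rw [real_inner_self_eq_norm_sq, show ‖gramEigenvector D j‖ = 1 from hon.1 j, one_pow]
      rw [this, mul_one]
    · intro i _ hij
      have : inner ℝ (gramEigenvector D j) (gramEigenvector D i) = 0 := hon.2 hij.symm
      simp [this]
    · simp
  rw [h2]
  split_ifs with h
  · have : gramEigenvalue D j ≠ 0 := by positivity
    simp only [id]
    field_simp
  · simp

theorem ridge_inv_mulVec_eigenvector (D : Dataset n) (j : Fin (n + 1)) :
    (ridge D)⁻¹ *ᵥ (gramEigenvector D j).ofLp =
      (1 + gramEigenvalue D j)⁻¹ • (gramEigenvector D j).ofLp := by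
  have h := gram_mulVec_eigenvector D j
  have h0 := gramEigenvalue_nonneg D j
  have h1 : ridge D *ᵥ (gramEigenvector D j).ofLp =
      (1 + gramEigenvalue D j) • (gramEigenvector D j).ofLp := by
    rw [ridge, add_mulVec, h, one_mulVec, add_smul, one_smul]
  have h2 : (gramEigenvector D j).ofLp =
      ridge D *ᵥ ((1 + gramEigenvalue D j)⁻¹ • (gramEigenvector D j).ofLp) := by
    rw [mulVec_smul, h1, smul_smul, inv_mul_cancel₀ (by positivity), one_smul]
  conv_lhs => rw [h2]
  rw [mulVec_mulVec, nonsing_inv_mul _ ((isUnit_iff_isUnit_det _).1 (ridge_posDef D).isUnit),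
    one_mulVec]

/-- Eigenvalue by eigenvalue: 1/(1+λ) is at least 1/(2λ) when λ ≥ 1 and at least 1/2 when λ < 1. -/
theorem norm_sq_add_norm_sq_le_leverage (D : Dataset n) (x : EuclideanSpace ℝ (Fin n)) :
    (‖qBar D x‖ ^ 2 + ‖uBar D x‖ ^ 2) / 2 ≤ leverage D x := by
  classical
  rw [leverage, quadratic_eq_sum_eigenvector (f := fun t => (1 + t)⁻¹)
    (fun j => ridge_inv_mulVec_eigenvector D j), norm_qBar_sq, norm_uBar_sq,
    ← Finset.sum_add_distrib, Finset.sum_div]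
  refine Finset.sum_le_sum fun j _ => ?_
  rw [← add_mul, mul_div_right_comm]
  refine mul_le_mul_of_nonneg_right ?_ (sq_nonneg _)
  have h0 := gramEigenvalue_nonneg D j
  split_ifs with h
  · rw [add_zero, div_eq_mul_inv, ← mul_inv]
    exact inv_anti₀ (by positivity) (by linarith)
  · rw [zero_add, one_div]
    exact inv_anti₀ (by positivity) (by linarith)

/-- The error of a rule `b` at `x` in terms of its in-sample error. -/
theorem abs_linearRule_sub_le (D : Dataset n) (b β : EuclideanSpace ℝ (Fin (n + 1)))
    (x : EuclideanSpace ℝ (Fin n)) :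
    |linearRule b x - linearRule β x| ≤
      √((b - β).ofLp ⬝ᵥ gramMatrix D *ᵥ (b - β).ofLp) * ‖qBar D x‖ + ‖b - β‖ * ‖uBar D x‖ := by
  classical
  set v := b - β with hv
  have hq := norm_qBar_sq D x
  have hu := norm_uBar_sq D x
  have hG := quadratic_eq_sum_eigenvector (f := id) (fun j => gram_mulVec_eigenvector D j) v
  have hN : ‖v‖ ^ 2 = ∑ j, inner ℝ (gramEigenvector D j) v ^ 2 := by
    have := dotProduct_eq_sum_eigenvector D v v
    simp only [← sq] at this
    rw [← this, EuclideanSpace.norm_sq_eq]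
    simp [dotProduct, sq]
  rw [linearRule_sub, ← hv, dotProduct_eq_sum_eigenvector D]
  set p : Fin (n + 1) → ℝ := fun j => inner ℝ (gramEigenvector D j) v
  set z : Fin (n + 1) → ℝ := fun j => inner ℝ (gramEigenvector D j) (augment x)
  set l : Fin (n + 1) → ℝ := fun j => gramEigenvalue D j
  have hl : ∀ j, 0 ≤ l j := gramEigenvalue_nonneg D
  -- The inner product is split at eigenvalue 1. On the large block the weights √λ and 1/√λ turn
  -- Cauchy–Schwarz into in-sample error times ‖q̄‖; the small block uses it unweighted.
  set f : Fin (n + 1) → ℝ := fun j => if 1 ≤ l j then √(l j) * p j else 0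
  set g : Fin (n + 1) → ℝ := fun j => if 1 ≤ l j then (√(l j))⁻¹ * z j else 0
  set f' : Fin (n + 1) → ℝ := fun j => if 1 ≤ l j then 0 else p j
  set g' : Fin (n + 1) → ℝ := fun j => if 1 ≤ l j then 0 else z j
  have hsplit : ∑ j, p j * z j = ∑ j, f j * g j + ∑ j, f' j * g' j := by
    rw [← Finset.sum_add_distrib]
    refine Finset.sum_congr rfl fun j _ => ?_
    simp only [f, g, f', g']
    split_ifs with h
    · have : √(l j) ≠ 0 := by positivity
      field_simp
      ring
    · ring
  have key : ∀ (F H : Fin (n + 1) → ℝ) (A B : ℝ), 0 ≤ A → 0 ≤ B → ∑ j, F j ^ 2 ≤ A ^ 2 →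
      ∑ j, H j ^ 2 ≤ B ^ 2 → |∑ j, F j * H j| ≤ A * B := by
    intro F H A B hA hB h1 h2
    refine abs_le_of_sq_le_sq ?_ (by positivity)
    calc (∑ j, F j * H j) ^ 2 ≤ (∑ j, F j ^ 2) * ∑ j, H j ^ 2 :=
          Finset.sum_mul_sq_le_sq_mul_sq _ _ _
      _ ≤ A ^ 2 * B ^ 2 := by gcongr
      _ = (A * B) ^ 2 := by ring
  rw [show (∑ j, inner ℝ (gramEigenvector D j) v * inner ℝ (gramEigenvector D j) (augment x)) =
    ∑ j, p j * z j from rfl, hsplit]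
  refine (abs_add_le _ _).trans (add_le_add ?_ ?_)
  · refine key _ _ _ _ (by positivity) (by positivity) ?_ ?_
    · have hG0 : 0 ≤ v.ofLp ⬝ᵥ gramMatrix D *ᵥ v.ofLp := by
        rw [hG]
        exact Finset.sum_nonneg fun j _ => mul_nonneg (hl j) (sq_nonneg _)
      rw [Real.sq_sqrt hG0, hG]
      refine Finset.sum_le_sum fun j _ => ?_
      simp only [f, id]
      split_ifs with h
      · rw [mul_pow, Real.sq_sqrt (hl j)]
      · rw [zero_pow two_ne_zero]; exact mul_nonneg (hl j) (sq_nonneg _)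
    · rw [hq]
      refine Finset.sum_le_sum fun j _ => ?_
      simp only [g, l, z]
      split_ifs with h
      · rw [mul_pow, inv_pow, Real.sq_sqrt (hl j)]
      · simp
  · refine key _ _ _ _ (by positivity) (by positivity) ?_ ?_
    · rw [hN]
      refine Finset.sum_le_sum fun j _ => ?_
      simp only [f']
      split_ifs with h
      · rw [zero_pow two_ne_zero]; positivity
      · exact le_rfl
    · rw [hu]
      refine Finset.sum_le_sum fun j _ => ?_
      simp only [g', l, z]
      split_ifs with h <;> simp

/-- Spectral functions that are limits of continuous functions are limits of polynomials. -/
theorem exists_polynomial_tendsto {f : ℝ → ℝ} {h : ℕ → ℝ → ℝ} (hc : ∀ k, Continuous (h k))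
    (hf : ∀ t, 0 ≤ t → Filter.Tendsto (fun k => h k t) Filter.atTop (nhds (f t))) :
    ∃ p : ℕ → Polynomial ℝ, ∀ t, 0 ≤ t →
      Filter.Tendsto (fun k => (p k).eval t) Filter.atTop (nhds (f t)) := by
  -- Weierstrass on the growing interval [0, k] with error 1/(k+1): every t ≥ 0 eventually lies
  -- inside.
  have h1 := fun k : ℕ => exists_polynomial_near_of_continuousOn 0 k (h k)
    (hc k).continuousOn (1 / ((k : ℝ) + 1)) (by positivity)
  choose p hp using h1
  refine ⟨p, fun t ht => ?_⟩
  refine (hf t ht).congr_dist ?_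
  refine squeeze_zero' (Filter.Eventually.of_forall fun k => dist_nonneg) ?_
    tendsto_one_div_add_atTop_nhds_zero_nat
  filter_upwards [Filter.eventually_ge_atTop ⌈t⌉₊] with k hk
  rw [dist_comm, Real.dist_eq]
  exact (hp k t ⟨ht, (Nat.le_ceil t).trans (by exact_mod_cast hk)⟩).le

theorem aeval_gram_mulVec_eigenvector (D : Dataset n) (p : Polynomial ℝ) (j : Fin (n + 1)) :
    Polynomial.aeval (gramMatrix D) p *ᵥ (gramEigenvector D j).ofLp =
      p.eval (gramEigenvalue D j) • (gramEigenvector D j).ofLp := by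
  induction p using Polynomial.induction_on' with
  | add p q hp hq => rw [map_add, add_mulVec, hp, hq, Polynomial.eval_add, add_smul]
  | monomial k a =>
    have hk : gramMatrix D ^ k *ᵥ (gramEigenvector D j).ofLp =
        gramEigenvalue D j ^ k • (gramEigenvector D j).ofLp := by
      induction k with
      | zero => simp
      | succ k ih =>
        rw [pow_succ, ← mulVec_mulVec, gram_mulVec_eigenvector, mulVec_smul, ih, smul_smul,
          pow_succ, mul_comm]
    rw [Polynomial.aeval_monomial, Polynomial.eval_monomial, ← Algebra.smul_def, smul_mulVec,
      hk, smul_smul]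

theorem tendsto_quadratic_polynomial {f : ℝ → ℝ} {p : ℕ → Polynomial ℝ}
    (hp : ∀ t, 0 ≤ t → Filter.Tendsto (fun k => (p k).eval t) Filter.atTop (nhds (f t)))
    (D : Dataset n) (v : EuclideanSpace ℝ (Fin (n + 1))) :
    Filter.Tendsto (fun k => v.ofLp ⬝ᵥ Polynomial.aeval (gramMatrix D) (p k) *ᵥ v.ofLp)
      Filter.atTop (nhds (∑ j, f (gramEigenvalue D j) *
        inner ℝ (gramEigenvector D j) v ^ 2)) := by
  have h : ∀ k, v.ofLp ⬝ᵥ Polynomial.aeval (gramMatrix D) (p k) *ᵥ v.ofLp =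
      ∑ j, (p k).eval (gramEigenvalue D j) * inner ℝ (gramEigenvector D j) v ^ 2 := fun k =>
    quadratic_eq_sum_eigenvector (f := fun t => (p k).eval t)
      (fun j => aeval_gram_mulVec_eigenvector D (p k) j) v
  simp only [h]
  exact tendsto_finsetSum _ fun j _ => (hp _ (gramEigenvalue_nonneg D j)).mul_const _

open Classical in
-- Ramps that reach 1 exactly at t = 1, so the limit takes the value 1 at the cutoff, as the
-- selection rule does.
theorem tendsto_step (t : ℝ) :
    Filter.Tendsto (fun k : ℕ => max 0 (min 1 (1 - k * (1 - t)))) Filter.atTop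
      (nhds (if 1 ≤ t then (1 : ℝ) else 0)) := by
  split_ifs with h
  · refine tendsto_const_nhds.congr fun k => ?_
    have : (k : ℝ) * (1 - t) ≤ 0 := mul_nonpos_of_nonneg_of_nonpos (by positivity) (by linarith)
    rw [min_eq_left (by linarith), max_eq_right zero_le_one]
  · refine tendsto_const_nhds.congr' ?_
    filter_upwards [Filter.eventually_ge_atTop ⌈(1 - t)⁻¹⌉₊] with k hk
    have h1 : (1 - t)⁻¹ ≤ k := (Nat.le_ceil _).trans (by exact_mod_cast hk)
    have h2 : 1 ≤ k * (1 - t) := by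
      rwa [inv_le_iff_one_le_mul₀ (by linarith)] at h1
    rw [max_eq_left]
    exact (min_le_right _ _).trans (by linarith)

open Classical in
theorem exists_polynomial_tendsto_qBar :
    ∃ p : ℕ → Polynomial ℝ, ∀ (n : ℕ) (D : Dataset n) (x : EuclideanSpace ℝ (Fin n)),
      Filter.Tendsto
        (fun k => (augment x).ofLp ⬝ᵥ
          Polynomial.aeval (gramMatrix D) (p k) *ᵥ (augment x).ofLp)
        Filter.atTop (nhds (‖qBar D x‖ ^ 2)) := by
  obtain ⟨p, hp⟩ := exists_polynomial_tendsto
    (f := fun t => if 1 ≤ t then t⁻¹ else 0)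
    -- Truncating at 1/2 keeps the inverse continuous and changes nothing where the limiting step is
    -- nonzero.
    (h := fun k t => max 0 (min 1 (1 - k * (1 - t))) * (max (1 / 2) t)⁻¹)
    (fun k => by
      refine Continuous.mul (by fun_prop) (Continuous.inv₀ (by fun_prop) fun t => ?_)
      have : (0 : ℝ) < max (1 / 2) t := lt_max_of_lt_left (by norm_num)
      exact this.ne')
    (fun t _ => by
      have := (tendsto_step t).mul_const (max (1 / 2) t)⁻¹
      convert this using 2
      split_ifs with h
      · rw [one_mul, max_eq_right (by linarith)]
      · rw [zero_mul])
  refine ⟨p, fun n D x => ?_⟩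
  rw [norm_qBar_sq]
  exact tendsto_quadratic_polynomial hp D _

open Classical in
theorem exists_polynomial_tendsto_uBar :
    ∃ p : ℕ → Polynomial ℝ, ∀ (n : ℕ) (D : Dataset n) (x : EuclideanSpace ℝ (Fin n)),
      Filter.Tendsto
        (fun k => (augment x).ofLp ⬝ᵥ
          Polynomial.aeval (gramMatrix D) (p k) *ᵥ (augment x).ofLp)
        Filter.atTop (nhds (‖uBar D x‖ ^ 2)) := by
  obtain ⟨p, hp⟩ := exists_polynomial_tendsto
    (f := fun t => if 1 ≤ t then 0 else 1)
    (h := fun k t => 1 - max 0 (min 1 (1 - k * (1 - t))))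
    (fun k => by fun_prop)
    (fun t _ => by
      have := (tendsto_step t).const_sub 1
      convert this using 2
      split_ifs <;> norm_num)
  refine ⟨p, fun n D x => ?_⟩
  rw [norm_uBar_sq]
  exact tendsto_quadratic_polynomial hp D _

end Spectral

/-! ### Measurability of the selection rule and of the run -/

section Measurability

open Matrix

section EntrywiseMeasurable

variable {Ω d : Type*} [MeasurableSpace Ω] [Fintype d]

theorem measurable_of_continuous_matrix {G : Ω → Matrix d d ℝ}
    (hG : ∀ i j, Measurable fun ω => G ω i j) {f : Matrix d d ℝ → ℝ} (hf : Continuous f) :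
    Measurable fun ω => f (G ω) := by
  have h1 : Measurable fun ω => (fun i j => G ω i j : d → d → ℝ) :=
    measurable_pi_lambda _ fun i => measurable_pi_lambda _ fun j => hG i j
  have h2 : Continuous fun A : d → d → ℝ => f (Matrix.of A) := hf
  exact h2.measurable.comp h1

theorem measurable_matrix_det [DecidableEq d] {G : Ω → Matrix d d ℝ}
    (hG : ∀ i j, Measurable fun ω => G ω i j) : Measurable fun ω => (G ω).det :=
  measurable_of_continuous_matrix hG (Continuous.matrix_det continuous_id)

theorem measurable_matrix_inv [DecidableEq d] {G : Ω → Matrix d d ℝ}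
    (hG : ∀ i j, Measurable fun ω => G ω i j) (i j : d) : Measurable fun ω => (G ω)⁻¹ i j := by
  have h : ∀ ω, (G ω)⁻¹ i j = (G ω).det⁻¹ * (G ω).adjugate i j := fun ω => by
    rw [Matrix.inv_def, Ring.inverse_eq_inv']; rfl
  simp only [h]
  exact (measurable_matrix_det hG).inv.mul (measurable_of_continuous_matrix hG
    ((continuous_apply_apply i j).comp (Continuous.matrix_adjugate continuous_id)))

theorem measurable_dotProduct_mulVec {G : Ω → Matrix d d ℝ} {u v : Ω → d → ℝ}
    (hG : ∀ i j, Measurable fun ω => G ω i j) (hu : ∀ i, Measurable fun ω => u ω i)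
    (hv : ∀ i, Measurable fun ω => v ω i) : Measurable fun ω => u ω ⬝ᵥ G ω *ᵥ v ω := by
  simp only [dotProduct, mulVec]
  exact Finset.measurable_fun_sum _ fun i _ => (hu i).mul
    (Finset.measurable_fun_sum _ fun j _ => (hG i j).mul (hv j))

theorem measurable_aeval_matrix [DecidableEq d] {G : Ω → Matrix d d ℝ}
    (hG : ∀ i j, Measurable fun ω => G ω i j) (p : Polynomial ℝ) (i j : d) :
    Measurable fun ω => Polynomial.aeval (G ω) p i j := by
  have h : Continuous fun A : Matrix d d ℝ => Polynomial.aeval A p := Polynomial.continuous_aeval p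
  exact measurable_of_continuous_matrix hG (h.matrix_elem i j)

end EntrywiseMeasurable

section DatasetMeasurability

variable {n : ℕ} {Ω : Type*}

theorem measurable_augment [MeasurableSpace Ω] {x : Ω → EuclideanSpace ℝ (Fin n)}
    (hx : Measurable x) (i : Fin (n + 1)) : Measurable fun ω => augment (x ω) i := by
  induction i using Fin.lastCases with
  | last => simp [augment]
  | cast i =>
    simp only [augment, Fin.snoc_castSucc]
    fun_prop

theorem measurable_linearRule [MeasurableSpace Ω] {x : Ω → EuclideanSpace ℝ (Fin n)}
    (hx : Measurable x) (β : EuclideanSpace ℝ (Fin (n + 1))) :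
    Measurable fun ω => linearRule β (x ω) := by
  simp only [linearRule_eq_dotProduct, dotProduct]
  exact Finset.measurable_fun_sum _ fun i _ => (measurable_augment hx i).const_mul _

variable [MeasurableSpace Ω] {x : Ω → EuclideanSpace ℝ (Fin n)} {D : Ω → Dataset n}
  {β : EuclideanSpace ℝ (Fin (n + 1))}

theorem measurable_ridge (hG : ∀ i j, Measurable fun ω => gramMatrix (D ω) i j)
    (i j : Fin (n + 1)) : Measurable fun ω => ridge (D ω) i j :=
  (hG i j).const_add _

theorem measurable_leverage (hx : Measurable x)
    (hG : ∀ i j, Measurable fun ω => gramMatrix (D ω) i j) :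
    Measurable fun ω => leverage (D ω) (x ω) :=
  measurable_dotProduct_mulVec (measurable_matrix_inv (measurable_ridge hG))
    (measurable_augment hx) (measurable_augment hx)

theorem measurable_ridgeError (hx : Measurable x)
    (hG : ∀ i j, Measurable fun ω => gramMatrix (D ω) i j)
    (hs : ∀ i, Measurable fun ω => score β (D ω) i) :
    Measurable fun ω => ridgeError β (D ω) (x ω) :=
  measurable_dotProduct_mulVec (measurable_matrix_inv (measurable_ridge hG))
    (measurable_augment hx) hs

theorem measurable_scoreNormSq (hG : ∀ i j, Measurable fun ω => gramMatrix (D ω) i j)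
    (hs : ∀ i, Measurable fun ω => score β (D ω) i) :
    Measurable fun ω => scoreNormSq β (D ω) :=
  measurable_dotProduct_mulVec (measurable_matrix_inv (measurable_ridge hG)) hs hs

/-- The eigenvectors are an arbitrary choice, possibly not measurable in the data. The two norms are
nevertheless limits of quadratic forms of polynomials in the Gram matrix, in which no choice enters.
-/
theorem measurableSet_sendsToCourt (a₁ a₂ : ℝ) (hx : Measurable x)
    (hG : ∀ i j, Measurable fun ω => gramMatrix (D ω) i j) :
    MeasurableSet {ω | SendsToCourt a₁ a₂ (D ω) (x ω)} := by
  obtain ⟨p, hp⟩ := exists_polynomial_tendsto_qBar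
  obtain ⟨q, hq⟩ := exists_polynomial_tendsto_uBar
  have key : ∀ r : Polynomial ℝ, Measurable fun ω => (augment (x ω)).ofLp ⬝ᵥ
      Polynomial.aeval (gramMatrix (D ω)) r *ᵥ (augment (x ω)).ofLp := fun r =>
    measurable_dotProduct_mulVec (measurable_aeval_matrix hG r) (measurable_augment hx)
      (measurable_augment hx)
  have h1 : Measurable fun ω => ‖qBar (D ω) (x ω)‖ := by
    have : Measurable fun ω => ‖qBar (D ω) (x ω)‖ ^ 2 :=
      measurable_of_tendsto_metrizable (fun k => key (p k))
        (tendsto_pi_nhds.2 fun ω => hp n (D ω) (x ω))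
    simpa using this.sqrt
  have h2 : Measurable fun ω => ‖uBar (D ω) (x ω)‖ := by
    have : Measurable fun ω => ‖uBar (D ω) (x ω)‖ ^ 2 :=
      measurable_of_tendsto_metrizable (fun k => key (q k))
        (tendsto_pi_nhds.2 fun ω => hq n (D ω) (x ω))
    simpa using this.sqrt
  exact ((measurableSet_le h1 measurable_const).inter
    (measurableSet_le h2 measurable_const)).compl

end DatasetMeasurability

section Run

variable {n : ℕ} {a₁ a₂ : ℝ} {x : ℕ → EuclideanSpace ℝ (Fin n)} {y : ℕ → ℝ}

theorem kwikData_succ_of_sends {t : ℕ} (h : KwikSends a₁ a₂ x y t) :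
    kwikData a₁ a₂ x y (t + 1) = kwikData a₁ a₂ x y t ++ [(x t, y t)] := by
  exact if_pos h

theorem kwikData_succ_of_not_sends {t : ℕ} (h : ¬ KwikSends a₁ a₂ x y t) :
    kwikData a₁ a₂ x y (t + 1) = kwikData a₁ a₂ x y t := by
  exact if_neg h

theorem norm_le_of_mem_kwikData (hx : ∀ t, ‖x t‖ ≤ 1) (t : ℕ) :
    ∀ p ∈ kwikData a₁ a₂ x y t, ‖p.1‖ ≤ 1 := by
  induction t with
  | zero => simp [kwikData]
  | succ t ih =>
    by_cases h : KwikSends a₁ a₂ x y t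
    · rw [kwikData_succ_of_sends h]
      intro p hp
      rcases List.mem_append.1 hp with hp | hp
      · exact ih p hp
      · rw [List.mem_singleton.1 hp]; exact hx t
    · rwa [kwikData_succ_of_not_sends h]

theorem kwikCount_succ (t : ℕ) [Decidable (KwikSends a₁ a₂ x y t)] :
    kwikCount a₁ a₂ x y (t + 1) =
      kwikCount a₁ a₂ x y t + if KwikSends a₁ a₂ x y t then 1 else 0 := by
  rw [kwikCount, kwikCount, Finset.range_add_one, Finset.filter_insert]
  split_ifs with h
  · rw [Finset.card_insert_of_notMem (by simp)]
  · rfl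

theorem kwikCost_succ (c : ℕ → ℝ) (t : ℕ) [Decidable (KwikSends a₁ a₂ x y t)] :
    kwikCost a₁ a₂ x y c (t + 1) =
      kwikCost a₁ a₂ x y c t + if KwikSends a₁ a₂ x y t then c t else 0 := by
  rw [kwikCost, kwikCost, Finset.range_add_one, Finset.filter_insert]
  split_ifs with h
  · rw [Finset.sum_insert (by simp), add_comm]
  · rw [add_zero]

theorem length_kwikData (t : ℕ) : (kwikData a₁ a₂ x y t).length = kwikCount a₁ a₂ x y t := by
  classical
  induction t with
  | zero => simp [kwikData, kwikCount]
  | succ t ih =>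
    rw [kwikCount_succ]
    split_ifs with h
    · rw [kwikData_succ_of_sends h, List.length_append, ih]; rfl
    · rw [kwikData_succ_of_not_sends h, ih, add_zero]

theorem SendsToCourt.le_leverage {a : ℝ} (ha : 0 ≤ a) {D : Dataset n}
    {x : EuclideanSpace ℝ (Fin n)} (h : SendsToCourt a a D x) : a ^ 2 / 2 ≤ leverage D x := by
  refine le_trans ?_ (norm_sq_add_norm_sq_le_leverage D x)
  rw [SendsToCourt, not_and_or, not_le, not_le] at h
  rcases h with h | h
  · have := pow_le_pow_left₀ ha h.le 2
    nlinarith [sq_nonneg ‖uBar D x‖]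
  · have := pow_le_pow_left₀ ha h.le 2
    nlinarith [sq_nonneg ‖qBar D x‖]

/-- The elliptical potential argument: each court case adds at least log(1 + a²/2) to log det. -/
theorem kwikCount_mul_log_le {a : ℝ} (ha : 0 ≤ a) (t : ℕ) :
    kwikCount a a x y t * Real.log (1 + a ^ 2 / 2) ≤
      Real.log (ridge (kwikData a a x y t)).det := by
  classical
  induction t with
  | zero => simp [kwikData, kwikCount]
  | succ t ih =>
    rw [kwikCount_succ]
    split_ifs with h
    · have h1 := SendsToCourt.le_leverage ha h
      have h2 := leverage_nonneg (kwikData a a x y t) (x t)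
      rw [kwikData_succ_of_sends h, det_ridge_append,
        Real.log_mul (ridge_posDef _).det_pos.ne' (by positivity)]
      have h3 := Real.log_le_log (x := 1 + a ^ 2 / 2) (by positivity) (add_le_add_right h1 1)
      push_cast
      linarith
    · rwa [kwikData_succ_of_not_sends h, add_zero]

theorem one_le_det_ridge (D : Dataset n) : 1 ≤ (ridge D).det := by
  induction D using List.reverseRecOn with
  | nil => simp
  | append_singleton D p ih =>
    rw [show p = (p.1, p.2) from rfl, det_ridge_append]
    nlinarith [leverage_nonneg D p.1]

end Run

section RunMeasurability

variable {n : ℕ} {Ω : Type*} {mΩ : MeasurableSpace Ω} {ℱ : Filtration ℕ mΩ}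
  {x : ℕ → Ω → EuclideanSpace ℝ (Fin n)} {y : ℕ → Ω → ℝ}

/-- The probabilistic part sees the dataset only through its Gram matrix and score, so these stand
in for measurability of the list itself. -/
theorem measurable_gramMatrix_score_kwikData (a₁ a₂ : ℝ) (β : EuclideanSpace ℝ (Fin (n + 1)))
    (hx : ∀ t, Measurable[ℱ t] (x t)) (hy : ∀ t, Measurable[ℱ (t + 1)] (y t)) (t : ℕ) :
    (∀ i j, Measurable[ℱ t] fun ω => gramMatrix (kwikData a₁ a₂ (x · ω) (y · ω) t) i j) ∧
      ∀ i, Measurable[ℱ t] fun ω => score β (kwikData a₁ a₂ (x · ω) (y · ω) t) i := by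
  classical
  induction t with
  | zero =>
    simp only [kwikData]
    exact ⟨fun _ _ => measurable_const, fun _ => measurable_const⟩
  | succ t ih =>
    have hle : ℱ t ≤ ℱ (t + 1) := ℱ.mono t.le_succ
    have hS : MeasurableSet[ℱ (t + 1)] {ω | KwikSends a₁ a₂ (x · ω) (y · ω) t} :=
      hle _ (@measurableSet_sendsToCourt n Ω (ℱ t) _ _ a₁ a₂ (hx t) ih.1)
    have hx' : Measurable[ℱ (t + 1)] (x t) := (hx t).mono hle le_rfl
    have hz := @measurable_augment n Ω (ℱ (t + 1)) _ hx'
    constructor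
    · intro i j
      have h : (fun ω => gramMatrix (kwikData a₁ a₂ (x · ω) (y · ω) (t + 1)) i j) = fun ω =>
          if KwikSends a₁ a₂ (x · ω) (y · ω) t then
            gramMatrix (kwikData a₁ a₂ (x · ω) (y · ω) t) i j +
              augment (x t ω) i * augment (x t ω) j
          else gramMatrix (kwikData a₁ a₂ (x · ω) (y · ω) t) i j := by
        funext ω
        split_ifs with h
        · rw [kwikData_succ_of_sends h, gram_append]; rfl
        · rw [kwikData_succ_of_not_sends h]
      rw [h]
      have h1 := (ih.1 i j).mono hle le_rfl
      exact Measurable.ite hS (h1.add ((hz i).mul (hz j))) h1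
    · intro i
      have h : (fun ω => score β (kwikData a₁ a₂ (x · ω) (y · ω) (t + 1)) i) = fun ω =>
          if KwikSends a₁ a₂ (x · ω) (y · ω) t then
            score β (kwikData a₁ a₂ (x · ω) (y · ω) t) i +
              (y t ω - linearRule β (x t ω)) * augment (x t ω) i
          else score β (kwikData a₁ a₂ (x · ω) (y · ω) t) i := by
        funext ω
        split_ifs with h
        · rw [kwikData_succ_of_sends h, score_append]; rfl
        · rw [kwikData_succ_of_not_sends h]
      rw [h]
      have h1 := (ih.2 i).mono hle le_rfl
      exact Measurable.ite hS (h1.add (((hy t).sub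
        (@measurable_linearRule n Ω (ℱ (t + 1)) _ hx' β)).mul (hz i))) h1

/-- Predictability: the decision at time t belongs to `ℱ t`, hence is independent of the noise and
of the cost at time t. -/
theorem measurableSet_kwikSends (a₁ a₂ : ℝ) (hx : ∀ t, Measurable[ℱ t] (x t))
    (hy : ∀ t, Measurable[ℱ (t + 1)] (y t)) (t : ℕ) :
    MeasurableSet[ℱ t] {ω | KwikSends a₁ a₂ (x · ω) (y · ω) t} :=
  @measurableSet_sendsToCourt n Ω (ℱ t) _ _ a₁ a₂ (hx t)
    (measurable_gramMatrix_score_kwikData a₁ a₂ 0 hx hy t).1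

end RunMeasurability

end Measurability

/-! ### Maximal inequalities and exponential kernels -/

section Concentration

open scoped ENNReal

section Supermartingale

/-- Multiplying by a kernel of an independent variable, of expectation at most `1`, does not
increase the expectation. -/
theorem lintegral_mul_kernel_le {Ω : Type*} {m mΩ : MeasurableSpace Ω} {μ : Measure Ω}
    [IsProbabilityMeasure μ] (hm : m ≤ mΩ)
    {β : Type*} [MeasurableSpace β] {Z : Ω → β} (hZ : Measurable[m] Z) {f : Ω → ℝ≥0∞}
    (hf : Measurable[m] f) {ξ : Ω → ℝ} (hξ : Measurable ξ)
    (hind : Indep (MeasurableSpace.comap ξ inferInstance) m μ)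
    {K : β → ℝ → ℝ≥0∞} (hK : Measurable (Function.uncurry K))
    (hK1 : ∀ z, ∫⁻ e, K z e ∂(μ.map ξ) ≤ 1) :
    ∫⁻ ω, f ω * K (Z ω) (ξ ω) ∂μ ≤ ∫⁻ ω, f ω ∂μ := by
  have hfm : Measurable f := hf.mono hm le_rfl
  have hZm : Measurable Z := hZ.mono hm le_rfl
  have hW : Measurable[m] fun ω => (f ω, Z ω) := hf.prodMk hZ
  have hWm : Measurable fun ω => (f ω, Z ω) := hfm.prodMk hZm
  -- By independence the joint law is a product, and Tonelli integrates the kernel first with Z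
  -- frozen.
  have hi : IndepFun (fun ω => (f ω, Z ω)) ξ μ :=
    indep_of_indep_of_le_left hind.symm hW.comap_le
  have hprod := (indepFun_iff_map_prod_eq_prod_map_map hWm.aemeasurable hξ.aemeasurable).1 hi
  have : IsProbabilityMeasure (μ.map ξ) := Measure.isProbabilityMeasure_map hξ.aemeasurable
  have hF : Measurable fun q : (ℝ≥0∞ × β) × ℝ => q.1.1 * K q.1.2 q.2 :=
    measurable_fst.fst.mul (hK.comp (measurable_fst.snd.prodMk measurable_snd))
  calc ∫⁻ ω, f ω * K (Z ω) (ξ ω) ∂μ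
      = ∫⁻ q, q.1.1 * K q.1.2 q.2 ∂(μ.map fun ω => ((f ω, Z ω), ξ ω)) :=
        (lintegral_map hF (hWm.prodMk hξ)).symm
    _ = ∫⁻ p, ∫⁻ e, p.1 * K p.2 e ∂(μ.map ξ) ∂(μ.map fun ω => (f ω, Z ω)) := by
        rw [hprod, lintegral_prod _ hF.aemeasurable]
    _ ≤ ∫⁻ p, p.1 ∂(μ.map fun ω => (f ω, Z ω)) := by
        refine lintegral_mono fun p => ?_
        have hKp : Measurable (K p.2) := hK.comp measurable_prodMk_left
        rw [lintegral_const_mul _ hKp]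
        exact mul_le_of_le_one_right' (hK1 p.2)
    _ = ∫⁻ ω, f ω ∂μ := lintegral_map measurable_fst hWm

variable {Ω : Type*} {mΩ : MeasurableSpace Ω} {μ : Measure Ω}

/-- **Ville's maximal inequality** for nonnegative supermartingales. -/
theorem measure_exists_ge_le {ℱ : Filtration ℕ mΩ} {M : ℕ → Ω → ℝ≥0∞}
    (hM : ∀ t, Measurable[ℱ t] (M t))
    (hstep : ∀ t A, MeasurableSet[ℱ t] A → ∫⁻ ω in A, M (t + 1) ω ∂μ ≤ ∫⁻ ω in A, M t ω ∂μ)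
    (c : ℝ≥0∞) : c * μ {ω | ∃ t, c ≤ M t ω} ≤ ∫⁻ ω, M 0 ω ∂μ := by
  set B : ℕ → Set Ω := fun N => {ω | ∀ t ≤ N, M t ω < c} with hB
  have hBm : ∀ N, MeasurableSet[ℱ N] (B N) := by
    intro N
    have : B N = ⋂ t ≤ N, {ω | M t ω < c} := by ext; simp [hB]
    rw [this]
    refine MeasurableSet.iInter fun t => MeasurableSet.iInter fun ht => ?_
    exact ℱ.mono ht _ ((hM t) measurableSet_Iio)
  have hBm' : ∀ N, MeasurableSet (B N) := fun N => ℱ.le N _ (hBm N)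
  have hMm : ∀ t, Measurable (M t) := fun t => (hM t).mono (ℱ.le t) le_rfl
  have hcross : ∀ (t : ℕ) (S : Set Ω), MeasurableSet S → (∀ ω ∈ S, c ≤ M t ω) →
      c * μ S ≤ ∫⁻ ω in S, M t ω ∂μ := by
    intro t S hS h
    rw [← setLIntegral_const]
    exact setLIntegral_mono (hMm t) h
  -- Stopping at the first crossing of c: paths already stopped contribute at least c, the others
  -- their current value, and the sum never exceeds the initial mean.
  have key : ∀ N, c * μ (B N)ᶜ + ∫⁻ ω in B N, M N ω ∂μ ≤ ∫⁻ ω, M 0 ω ∂μ := by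
    intro N
    induction N with
    | zero =>
      rw [← lintegral_add_compl (μ := μ) (M 0) (hBm' 0), add_comm]
      gcongr
      refine hcross 0 _ (hBm' 0).compl fun ω hω => ?_
      simpa [hB] using hω
    | succ N ih =>
      refine le_trans ?_ ih
      have hsub : B (N + 1) ⊆ B N := fun ω hω t ht => hω t (ht.trans N.le_succ)
      have h1 : (B (N + 1))ᶜ = (B N)ᶜ ∪ (B N \ B (N + 1)) := by
        ext ω
        have := @hsub ω
        simp only [Set.mem_compl_iff, Set.mem_union, Set.mem_sdiff]
        tauto
      have h2 : B N = (B N \ B (N + 1)) ∪ B (N + 1) := (Set.sdiff_union_of_subset hsub).symm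
      have h3 : ∫⁻ ω in B N, M (N + 1) ω ∂μ = ∫⁻ ω in B N \ B (N + 1), M (N + 1) ω ∂μ +
          ∫⁻ ω in B (N + 1), M (N + 1) ω ∂μ := by
        conv_lhs => rw [h2]
        exact lintegral_union (hBm' _) Set.disjoint_sdiff_left
      calc c * μ (B (N + 1))ᶜ + ∫⁻ ω in B (N + 1), M (N + 1) ω ∂μ
          ≤ c * (μ (B N)ᶜ + μ (B N \ B (N + 1))) + ∫⁻ ω in B (N + 1), M (N + 1) ω ∂μ := by
            rw [h1]; gcongr; exact measure_union_le _ _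
        _ = c * μ (B N)ᶜ +
            (c * μ (B N \ B (N + 1)) + ∫⁻ ω in B (N + 1), M (N + 1) ω ∂μ) := by ring
        _ ≤ c * μ (B N)ᶜ + ∫⁻ ω in B N, M (N + 1) ω ∂μ := by
            rw [h3]
            gcongr
            refine hcross (N + 1) _ ((hBm' N).diff (hBm' _)) fun ω hω => ?_
            by_contra! hlt
            refine hω.2 fun t ht => ?_
            rcases Nat.le_succ_iff.1 ht with ht | ht
            · exact hω.1 t ht
            · rw [ht]; exact hlt
        _ ≤ _ := by gcongr c * μ (B N)ᶜ + ?_; exact hstep N _ (hBm N)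
  have hU : {ω | ∃ t, c ≤ M t ω} = ⋃ N, (B N)ᶜ := by
    ext ω
    simp only [hB, Set.mem_ofPred_eq, Set.mem_iUnion, Set.mem_compl_iff, not_forall, not_lt]
    exact ⟨fun ⟨t, h⟩ => ⟨t, t, le_rfl, h⟩, fun ⟨_, t, _, h⟩ => ⟨t, h⟩⟩
  have hmono : Monotone fun N => (B N)ᶜ := fun N N' hN =>
    Set.compl_subset_compl.2 fun ω hω t ht => hω t (ht.trans hN)
  rw [hU, hmono.measure_iUnion, ENNReal.mul_iSup]
  exact iSup_le fun N => le_self_add.trans (key N)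

/-- A maximal inequality for products of kernels evaluated at independent variables. -/
theorem measure_exists_exp_ge_le [IsProbabilityMeasure μ] {ℱ : Filtration ℕ mΩ} {L : ℕ → Ω → ℝ}
    (hL : ∀ t, Measurable[ℱ t] (L t)) (hL0 : ∀ ω, L 0 ω = 0)
    {β : Type*} [MeasurableSpace β] {Z : ℕ → Ω → β} (hZ : ∀ t, Measurable[ℱ t] (Z t))
    {ξ : ℕ → Ω → ℝ} (hξ : ∀ t, Measurable (ξ t))
    (hind : ∀ t, Indep (MeasurableSpace.comap (ξ t) inferInstance) (ℱ t) μ)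
    {k : β → ℝ → ℝ} (hk : Measurable (Function.uncurry k))
    (hk1 : ∀ t z, ∫⁻ e, ENNReal.ofReal (Real.exp (k z e)) ∂(μ.map (ξ t)) ≤ 1)
    (hstep : ∀ t ω, L (t + 1) ω = L t ω + k (Z t ω) (ξ t ω)) {δ : ℝ} (hδ : 0 < δ) :
    μ {ω | ∃ t, Real.log (1 / δ) ≤ L t ω} ≤ ENNReal.ofReal δ := by
  have hV := measure_exists_ge_le (μ := μ) (ℱ := ℱ)
    (M := fun t ω => ENNReal.ofReal (Real.exp (L t ω)))
    (fun t => (Real.measurable_exp.comp (hL t)).ennreal_ofReal) ?_ (ENNReal.ofReal (1 / δ))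
  · simp only [hL0, Real.exp_zero, ENNReal.ofReal_one, lintegral_one, measure_univ] at hV
    have hset : {ω | ∃ t, Real.log (1 / δ) ≤ L t ω} =
        {ω | ∃ t, ENNReal.ofReal (1 / δ) ≤ ENNReal.ofReal (Real.exp (L t ω))} := by
      ext ω
      simp only [Set.mem_ofPred_eq]
      refine exists_congr fun t => ?_
      rw [ENNReal.ofReal_le_ofReal_iff (Real.exp_pos _).le, Real.log_le_iff_le_exp (by positivity)]
    rw [hset]
    calc _ = ENNReal.ofReal δ * (ENNReal.ofReal (1 / δ) *
          μ {ω | ∃ t, ENNReal.ofReal (1 / δ) ≤ ENNReal.ofReal (Real.exp (L t ω))}) := by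
          rw [← mul_assoc, ← ENNReal.ofReal_mul hδ.le, mul_one_div_cancel hδ.ne',
            ENNReal.ofReal_one, one_mul]
      _ ≤ ENNReal.ofReal δ * 1 := by gcongr
      _ = _ := mul_one _
  · intro t A hA
    have hA' := ℱ.le t _ hA
    rw [← lintegral_indicator hA', ← lintegral_indicator hA']
    have h := lintegral_mul_kernel_le (μ := μ) (ℱ.le t) (hZ t)
      (f := A.indicator fun ω => ENNReal.ofReal (Real.exp (L t ω)))
      (Measurable.indicator (Real.measurable_exp.comp (hL t)).ennreal_ofReal hA)
      (hξ t) (hind t) (K := fun z e => ENNReal.ofReal (Real.exp (k z e)))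
      (Real.measurable_exp.comp hk).ennreal_ofReal (hk1 t)
    refine (le_of_eq ?_).trans h
    refine lintegral_congr fun ω => ?_
    by_cases hω : ω ∈ A
    · simp only [Set.indicator_of_mem hω]
      rw [hstep, Real.exp_add, ENNReal.ofReal_mul (Real.exp_pos _).le]
    · simp [Set.indicator_of_notMem hω]

end Supermartingale

section Kernels

/-- The variance proxy used for noise of standard deviation `σ`; it is positive also for `σ = 0`. -/
noncomputable def varianceProxy (σ : NNReal) : ℝ := if σ = 0 then 1 else (σ : ℝ) ^ 2

theorem varianceProxy_pos (σ : NNReal) : 0 < varianceProxy σ := by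
  rw [varianceProxy]
  split_ifs with h
  · exact one_pos
  · have : 0 < σ := pos_iff_ne_zero.2 h
    positivity

/-- For σ > 0 the kernel times the N(0, σ²) density is exactly the density of N(a, σ²(1+w)). For σ =
0 the noise vanishes and the exponent is nonpositive. -/
theorem lintegral_gaussian_kernel_le (σ : NNReal) {w : ℝ} (hw : 0 ≤ w) (a : ℝ) :
    ∫⁻ e, ENNReal.ofReal (Real.exp ((2 * e * a + e ^ 2 * w - a ^ 2) /
      (2 * varianceProxy σ * (1 + w)) - Real.log (1 + w) / 2)) ∂(gaussianReal 0 (σ ^ 2)) ≤ 1 := by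
  have hr := varianceProxy_pos σ
  by_cases hσ : σ = 0
  · rw [hσ, zero_pow two_ne_zero, gaussianReal_zero_var, lintegral_dirac' _ (by fun_prop)]
    rw [← ENNReal.ofReal_one]
    refine ENNReal.ofReal_le_ofReal (Real.exp_le_one_iff.2 ?_)
    have h1 : 0 ≤ Real.log (1 + w) := Real.log_nonneg (by linarith)
    have hr := varianceProxy_pos 0
    have h2 : (2 * 0 * a + 0 ^ 2 * w - a ^ 2) / (2 * varianceProxy 0 * (1 + w)) ≤ 0 :=
      div_nonpos_of_nonpos_of_nonneg (by nlinarith [sq_nonneg a]) (by positivity)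
    linarith
  · have hv : σ ^ 2 ≠ 0 := pow_ne_zero _ hσ
    have hr' : varianceProxy σ = (σ : ℝ) ^ 2 := if_neg hσ
    rw [gaussianReal_of_var_ne_zero _ hv,
      lintegral_withDensity_eq_lintegral_mul _ (measurable_gaussianPDF _ _) (by fun_prop)]
    set v' : NNReal := σ ^ 2 * (1 + w).toNNReal with hv'
    have hv0 : v' ≠ 0 := mul_ne_zero hv (Real.toNNReal_pos.2 (by linarith)).ne'
    refine (lintegral_congr fun e => ?_).trans_le (lintegral_gaussianPDF_eq_one a hv0).le
    have hs : (0 : ℝ) < σ := by positivity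
    simp only [Pi.mul_apply, gaussianPDF]
    rw [← ENNReal.ofReal_mul (gaussianPDFReal_nonneg _ _ _)]
    congr 1
    rw [gaussianPDFReal, gaussianPDFReal, hr', Real.exp_sub, ← Real.log_sqrt (by linarith),
      Real.exp_log (Real.sqrt_pos.2 (by linarith))]
    have hv'' : (v' : ℝ) = (σ : ℝ) ^ 2 * (1 + w) := by
      rw [hv', NNReal.coe_mul, NNReal.coe_pow, Real.coe_toNNReal _ (by linarith)]
    rw [hv'', NNReal.coe_pow, ← mul_assoc (2 * Real.pi), Real.sqrt_mul (by positivity) (1 + w), mul_inv]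
    rw [show (√(2 * Real.pi * (σ : ℝ) ^ 2))⁻¹ * Real.exp (-(e - 0) ^ 2 / (2 * (σ : ℝ) ^ 2)) *
      (Real.exp ((2 * e * a + e ^ 2 * w - a ^ 2) / (2 * (σ : ℝ) ^ 2 * (1 + w))) / √(1 + w)) =
      (√(2 * Real.pi * (σ : ℝ) ^ 2))⁻¹ * (√(1 + w))⁻¹ *
      (Real.exp (-(e - 0) ^ 2 / (2 * (σ : ℝ) ^ 2)) *
      Real.exp ((2 * e * a + e ^ 2 * w - a ^ 2) / (2 * (σ : ℝ) ^ 2 * (1 + w)))) by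
        rw [div_eq_mul_inv]; ring, ← Real.exp_add]
    congr 2
    field_simp
    ring

/-- The previous kernel at w = 1 and a = 0, up to a factor √2 ≤ 2. -/
theorem lintegral_exp_sq_le (σ : NNReal) :
    ∫⁻ e, ENNReal.ofReal (Real.exp (e ^ 2 / (4 * varianceProxy σ)))
      ∂(gaussianReal 0 (σ ^ 2)) ≤ 2 := by
  have h := lintegral_gaussian_kernel_le σ zero_le_one 0
  have hr := varianceProxy_pos σ
  have h2 : ∀ e : ℝ, ENNReal.ofReal (Real.exp (e ^ 2 / (4 * varianceProxy σ))) ≤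
      2 * ENNReal.ofReal (Real.exp ((2 * e * 0 + e ^ 2 * 1 - 0 ^ 2) /
      (2 * varianceProxy σ * (1 + 1)) - Real.log (1 + 1) / 2)) := by
    intro e
    rw [show (2 : ENNReal) = ENNReal.ofReal 2 by simp, ← ENNReal.ofReal_mul (by norm_num)]
    refine ENNReal.ofReal_le_ofReal ?_
    rw [← Real.exp_log (show (0 : ℝ) < 2 by norm_num), ← Real.exp_add, Real.exp_le_exp]
    have h3 : (2 * e * 0 + e ^ 2 * 1 - 0 ^ 2) / (2 * varianceProxy σ * (1 + 1)) =
      e ^ 2 / (4 * varianceProxy σ) := by congr 1 <;> ring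
    have h4 : 0 < Real.log 2 := Real.log_pos (by norm_num)
    rw [Real.exp_log (by norm_num), h3, one_add_one_eq_two]
    linarith
  calc _ ≤ ∫⁻ e, 2 * ENNReal.ofReal (Real.exp ((2 * e * 0 + e ^ 2 * 1 - 0 ^ 2) /
      (2 * varianceProxy σ * (1 + 1)) - Real.log (1 + 1) / 2)) ∂(gaussianReal 0 (σ ^ 2)) :=
        lintegral_mono h2
    _ ≤ 2 * 1 := by rw [lintegral_const_mul' _ _ (by simp)]; gcongr
    _ = 2 := mul_one _

/-- On [0, 1] one has eᵘ ≤ 1 + 2u, so the mean of e^{z/b} is at most 1 + 2c₀/b ≤ e^{2c₀/b}. The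
factor 2 on the mean cost originates here. -/
theorem lintegral_exp_cost_le {P : Measure ℝ} [IsProbabilityMeasure P] {b c₀ : ℝ} (hb : 0 < b)
    (hP : ∀ᵐ z ∂P, 0 ≤ z ∧ z ≤ b) (hc : c₀ = ∫ z, z ∂P) :
    ∫⁻ z, ENNReal.ofReal (Real.exp ((z - 2 * c₀) / b)) ∂P ≤ 1 := by
  have hint : Integrable (fun z : ℝ => z) P :=
    Integrable.of_bound (by fun_prop) b (hP.mono fun z hz => by
      rw [Real.norm_of_nonneg hz.1]; exact hz.2)
  have h1 : ∀ᵐ z ∂P, Real.exp ((z - 2 * c₀) / b) ≤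
      Real.exp (-(2 * c₀ / b)) * (1 + 2 / b * z) := by
    filter_upwards [hP] with z hz
    rw [show (z - 2 * c₀) / b = -(2 * c₀ / b) + z / b by ring, Real.exp_add]
    gcongr
    have h0 : 0 ≤ z / b := div_nonneg hz.1 hb.le
    have h2 : z / b ≤ 1 := (div_le_one hb).2 hz.2
    have h3 := Real.abs_exp_sub_one_sub_id_le (x := z / b) (by rwa [abs_of_nonneg h0])
    have h4 := (abs_le.1 h3).2
    have h5 : 2 / b * z = 2 * (z / b) := by ring
    nlinarith
  have hint2 : Integrable (fun z => Real.exp (-(2 * c₀ / b)) * (1 + 2 / b * z)) P :=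
    ((integrable_const _).add (hint.const_mul _)).const_mul _
  calc ∫⁻ z, ENNReal.ofReal (Real.exp ((z - 2 * c₀) / b)) ∂P
      ≤ ∫⁻ z, ENNReal.ofReal (Real.exp (-(2 * c₀ / b)) * (1 + 2 / b * z)) ∂P :=
        lintegral_mono_ae (h1.mono fun z hz => ENNReal.ofReal_le_ofReal hz)
    _ = ENNReal.ofReal (∫ z, Real.exp (-(2 * c₀ / b)) * (1 + 2 / b * z) ∂P) := by
        rw [ofReal_integral_eq_lintegral_ofReal hint2]
        filter_upwards [h1] with z hz
        exact (Real.exp_pos _).le.trans hz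
    _ ≤ ENNReal.ofReal 1 := by
        refine ENNReal.ofReal_le_ofReal ?_
        rw [integral_const_mul, integral_add (integrable_const _) (hint.const_mul _),
          integral_const_mul, ← hc]
        simp only [integral_const, probReal_univ, one_smul]
        rw [Real.exp_neg, inv_mul_le_iff₀ (Real.exp_pos _), mul_one, div_mul_eq_mul_div, add_comm]
        exact Real.add_one_le_exp _
    _ = 1 := ENNReal.ofReal_one

end Kernels

end Concentration

/-! ### Error bounds and the three high-probability events -/

section Guarantees

open Matrix
open scoped ENNReal

section Deterministic

variable {n : ℕ}

theorem abs_linearRule_sub_le_of_error_le {a Q : ℝ} {D : Dataset n} {x : EuclideanSpace ℝ (Fin n)}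
    (h : ¬ SendsToCourt a a D x) {b β : EuclideanSpace ℝ (Fin (n + 1))} (hb : ‖b‖ ≤ 1)
    (hβ : ‖β‖ ≤ 1) (hQ : (b - β).ofLp ⬝ᵥ gramMatrix D *ᵥ (b - β).ofLp ≤ Q) :
    |linearRule b x - linearRule β x| ≤ a * (√Q + 2) := by
  obtain ⟨h1, h2⟩ := not_not.1 h
  have h3 : ‖b - β‖ ≤ 2 := (norm_sub_le _ _).trans (by linarith)
  have ha : 0 ≤ a := (norm_nonneg _).trans h1
  calc _ ≤ _ := abs_linearRule_sub_le D b β x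
    _ ≤ √Q * a + 2 * a := by gcongr
    _ = _ := by ring

theorem IsConstrainedLeastSquares.abs_sub_le {a : ℝ} {D : Dataset n}
    {x : EuclideanSpace ℝ (Fin n)} (h : ¬ SendsToCourt a a D x)
    {b β : EuclideanSpace ℝ (Fin (n + 1))} (hb : IsConstrainedLeastSquares D b) (hβ : ‖β‖ ≤ 1) :
    |linearRule b x - linearRule β x| ≤ a * (√(4 * scoreNormSq β D + 4) + 2) :=
  abs_linearRule_sub_le_of_error_le h hb.1 hβ (hb.error_le hβ)

/-- The thresholds were tested against D alone. The extra point only adds a square to the Gram form,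
so the in-sample error of the enlarged fit still bounds its error on D. -/
theorem IsConstrainedLeastSquares.abs_sub_le_of_append {a : ℝ} {D : Dataset n}
    {x : EuclideanSpace ℝ (Fin n)} {y : ℝ} (h : ¬ SendsToCourt a a D x)
    {b β : EuclideanSpace ℝ (Fin (n + 1))} (hb : IsConstrainedLeastSquares (D ++ [(x, y)]) b)
    (hβ : ‖β‖ ≤ 1) :
    |linearRule b x - linearRule β x| ≤
      a * (√(4 * (scoreNormSq β D + (y - linearRule β x) ^ 2) + 4) + 2) := by
  refine abs_linearRule_sub_le_of_error_le h hb.1 hβ ?_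
  have h1 := hb.error_le hβ
  have h2 := scoreNormSq_append_le β D x y
  rw [dotProduct_gram_mulVec, List.map_append, List.sum_append, ← dotProduct_gram_mulVec] at h1
  have h3 : 0 ≤ ([(x, y)].map fun p : EuclideanSpace ℝ (Fin n) × ℝ =>
      ((b - β).ofLp ⬝ᵥ (augment p.1).ofLp) ^ 2).sum := by
    simpa using sq_nonneg _
  linarith

theorem abs_linearRule_sub_le_three {b β : EuclideanSpace ℝ (Fin (n + 1))}
    {x : EuclideanSpace ℝ (Fin n)} (hb : ‖b‖ ≤ 1) (hβ : ‖β‖ ≤ 1) (hx : ‖x‖ ≤ 1) :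
    |linearRule b x - linearRule β x| ≤ 3 := by
  have h1 : ‖b - β‖ ≤ 2 := (norm_sub_le _ _).trans (by linarith)
  have h2 : ‖augment x‖ ≤ 3 / 2 := by
    refine abs_le_of_sq_le_sq' ?_ (by norm_num) |>.2
    rw [norm_augment_sq]
    nlinarith [norm_nonneg x]
  rw [linearRule, linearRule, ← inner_sub_left]
  calc _ ≤ ‖b - β‖ * ‖augment x‖ := abs_real_inner_le_norm _ _
    _ ≤ 2 * (3 / 2) := by gcongr
    _ = 3 := by norm_num

theorem not_sendsToCourt_nil {x : EuclideanSpace ℝ (Fin n)} (hx : ‖x‖ ≤ 1) :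
    ¬ SendsToCourt 1 2 [] x := by
  classical
  refine not_not.2 ⟨?_, ?_⟩
  · have : ‖qBar [] x‖ = 0 := by
      rw [EuclideanSpace.norm_eq]
      simp
    rw [this]; exact zero_le_one
  · refine abs_le_of_sq_le_sq' ?_ (by norm_num) |>.2
    have h1 : ‖augment x‖ ^ 2 = ∑ j, inner ℝ (gramEigenvector [] j) (augment x) ^ 2 := by
      have := dotProduct_eq_sum_eigenvector [] (augment x) (augment x)
      simp only [← sq] at this
      rw [← this, EuclideanSpace.norm_sq_eq]
      simp [dotProduct, sq]
    have h2 : ‖uBar [] x‖ ^ 2 ≤ ‖augment x‖ ^ 2 := by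
      rw [norm_uBar_sq, h1]
      refine Finset.sum_le_sum fun j _ => ?_
      split_ifs
      · rw [zero_mul]; positivity
      · rw [one_mul]
    rw [norm_augment_sq] at h2
    nlinarith [norm_nonneg x]

theorem kwikData_eq_nil {x : ℕ → EuclideanSpace ℝ (Fin n)} (hx : ∀ t, ‖x t‖ ≤ 1) (y : ℕ → ℝ)
    (t : ℕ) : kwikData 1 2 x y t = [] := by
  induction t with
  | zero => rfl
  | succ t ih =>
    rw [kwikData_succ_of_not_sends, ih]
    rw [KwikSends, ih]
    exact not_sendsToCourt_nil (hx t)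

theorem not_kwikSends {x : ℕ → EuclideanSpace ℝ (Fin n)} (hx : ∀ t, ‖x t‖ ≤ 1) (y : ℕ → ℝ)
    (t : ℕ) : ¬ KwikSends 1 2 x y t := by
  rw [KwikSends, kwikData_eq_nil hx]
  exact not_sendsToCourt_nil (hx t)

end Deterministic

section Events

variable {n : ℕ} {Ω : Type*} {mΩ : MeasurableSpace Ω} {μ : Measure Ω}
  {σ : NNReal} {P : Measure ℝ} {ℱ : Filtration ℕ mΩ} {x : ℕ → Ω → EuclideanSpace ℝ (Fin n)}
  {η c y : ℕ → Ω → ℝ} {β : EuclideanSpace ℝ (Fin (n + 1))}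

theorem IsCourtProcess.measurable_observation (h : IsCourtProcess μ σ P ℱ x η c)
    (hy : ∀ t ω, y t ω = linearRule β (x t ω) + η t ω) (t : ℕ) : Measurable[ℱ (t + 1)] (y t) := by
  have hle : ℱ t ≤ ℱ (t + 1) := ℱ.mono t.le_succ
  rw [funext (hy t)]
  exact (@measurable_linearRule n Ω (ℱ (t + 1)) _ ((h.case_measurable t).mono hle le_rfl) β).add
    (h.noise_measurable t)

/-- The self-normalized bound for the noise collected by the algorithm. -/
theorem IsCourtProcess.measure_scoreNormSq_ge_le [IsProbabilityMeasure μ]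
    (h : IsCourtProcess μ σ P ℱ x η c)
    (hy : ∀ t ω, y t ω = linearRule β (x t ω) + η t ω) (a₁ a₂ : ℝ) {δ : ℝ} (hδ : 0 < δ) :
    μ {ω | ∃ t, Real.log (1 / δ) ≤
      scoreNormSq β (kwikData a₁ a₂ (x · ω) (y · ω) t) / (2 * varianceProxy σ) -
        Real.log (ridge (kwikData a₁ a₂ (x · ω) (y · ω) t)).det / 2} ≤ ENNReal.ofReal δ := by
  classical
  have hr := varianceProxy_pos σ
  have hym := h.measurable_observation hy
  have hm := measurable_gramMatrix_score_kwikData a₁ a₂ β h.case_measurable hym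
  have hS := measurableSet_kwikSends a₁ a₂ h.case_measurable hym
  refine measure_exists_exp_ge_le (μ := μ) (ℱ := ℱ)
    (L := fun t ω => scoreNormSq β (kwikData a₁ a₂ (x · ω) (y · ω) t) / (2 * varianceProxy σ) -
        Real.log (ridge (kwikData a₁ a₂ (x · ω) (y · ω) t)).det / 2)
    (fun t => ?_) (fun ω => ?_)
    -- The default (0, 0) makes the kernel vanish, so a case not sent leaves the process unchanged.
    (Z := fun t ω => if KwikSends a₁ a₂ (x · ω) (y · ω) t then
      (leverage (kwikData a₁ a₂ (x · ω) (y · ω) t) (x t ω),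
        ridgeError β (kwikData a₁ a₂ (x · ω) (y · ω) t) (x t ω)) else (0, 0))
    (fun t => ?_) (ξ := η) (fun t => (h.noise_measurable t).mono (ℱ.le _) le_rfl) h.noise_indep
    -- The absolute value makes the kernel bound valid for every z; it is harmless since leverages
    -- are nonnegative.
    (k := fun z e => (2 * e * z.2 + e ^ 2 * |z.1| - z.2 ^ 2) /
      (2 * varianceProxy σ * (1 + |z.1|)) - Real.log (1 + |z.1|) / 2)
    ?_ (fun t z => ?_) (fun t ω => ?_) hδ
  · exact ((@measurable_scoreNormSq n Ω (ℱ t) _ β (hm t).1 (hm t).2).div_const _).sub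
      ((Real.measurable_log.comp (@measurable_matrix_det Ω _ (ℱ t) _ _ _
        (@measurable_ridge n Ω (ℱ t) _ (hm t).1))).div_const _)
  · simp [kwikData, scoreNormSq]
  · exact Measurable.ite (hS t)
      ((@measurable_leverage n Ω (ℱ t) _ _ (h.case_measurable t) (hm t).1).prodMk
        (@measurable_ridgeError n Ω (ℱ t) _ _ β (h.case_measurable t) (hm t).1 (hm t).2))
      measurable_const
  · simp only [Function.uncurry_def]
    fun_prop
  · rw [h.noise_law t]
    exact lintegral_gaussian_kernel_le σ (abs_nonneg _) _
  · split_ifs with hs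
    · have hl := leverage_nonneg (kwikData a₁ a₂ (x · ω) (y · ω) t) (x t ω)
      rw [kwikData_succ_of_sends hs, scoreNormSq_append, det_ridge_append,
        Real.log_mul (ridge_posDef _).det_pos.ne' (by positivity), abs_of_nonneg hl,
        show y t ω - linearRule β (x t ω) = η t ω by rw [hy]; ring]
      field_simp
      ring
    · rw [kwikData_succ_of_not_sends hs]
      simp

/-- Markov's inequality for exp(η²/(4r)), whose mean is at most 2, gives δ/(T+1) per case; then a
union bound. Using T + 1 avoids dividing by zero at T = 0. -/
theorem IsCourtProcess.measure_noise_sq_ge_le (h : IsCourtProcess μ σ P ℱ x η c) (T : ℕ) {δ : ℝ}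
    (hδ : 0 < δ) :
    μ {ω | ∃ t < T, 4 * varianceProxy σ * Real.log (2 * (T + 1) / δ) ≤ η t ω ^ 2} ≤
      ENNReal.ofReal δ := by
  have hr := varianceProxy_pos σ
  set B : ℝ := 2 * (T + 1) / δ with hB
  have hBpos : 0 < B := by positivity
  have h1 : ∀ t, μ {ω | 4 * varianceProxy σ * Real.log B ≤ η t ω ^ 2} ≤
      ENNReal.ofReal (δ / (T + 1)) := by
    intro t
    have hηm : Measurable (η t) := (h.noise_measurable t).mono (ℱ.le _) le_rfl
    have hexp : ∫⁻ ω, ENNReal.ofReal (Real.exp (η t ω ^ 2 / (4 * varianceProxy σ))) ∂μ ≤ 2 := by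
      have := lintegral_exp_sq_le σ
      rwa [← h.noise_law t, lintegral_map (by fun_prop) hηm] at this
    have hM := mul_meas_ge_le_lintegral (μ := μ)
      (f := fun ω => ENNReal.ofReal (Real.exp (η t ω ^ 2 / (4 * varianceProxy σ))))
      (by fun_prop) (ENNReal.ofReal B)
    have hset : {ω | 4 * varianceProxy σ * Real.log B ≤ η t ω ^ 2} =
        {ω | ENNReal.ofReal B ≤
          ENNReal.ofReal (Real.exp (η t ω ^ 2 / (4 * varianceProxy σ)))} := by
      ext ω
      simp only [Set.mem_ofPred_eq]
      rw [ENNReal.ofReal_le_ofReal_iff (Real.exp_pos _).le, ← Real.log_le_iff_le_exp hBpos,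
        le_div_iff₀ (by positivity), mul_comm]
    rw [← hset] at hM
    have hM2 := hM.trans hexp
    calc _ = ENNReal.ofReal B⁻¹ * (ENNReal.ofReal B *
          μ {ω | 4 * varianceProxy σ * Real.log B ≤ η t ω ^ 2}) := by
          rw [← mul_assoc, ← ENNReal.ofReal_mul (by positivity), inv_mul_cancel₀ hBpos.ne',
            ENNReal.ofReal_one, one_mul]
      _ ≤ ENNReal.ofReal B⁻¹ * 2 := by gcongr
      _ = ENNReal.ofReal (B⁻¹ * 2) := by
          rw [ENNReal.ofReal_mul (by positivity)]; simp
      _ = _ := by congr 1; rw [hB]; field_simp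
  have hU : {ω | ∃ t < T, 4 * varianceProxy σ * Real.log B ≤ η t ω ^ 2} =
      ⋃ t ∈ Finset.range T, {ω | 4 * varianceProxy σ * Real.log B ≤ η t ω ^ 2} := by
    ext ω; simp
  rw [hU]
  calc _ ≤ ∑ t ∈ Finset.range T, μ {ω | 4 * varianceProxy σ * Real.log B ≤ η t ω ^ 2} :=
        measure_biUnion_finset_le _ _
    _ ≤ ∑ t ∈ Finset.range T, ENNReal.ofReal (δ / (T + 1)) := Finset.sum_le_sum fun t _ => h1 t
    _ = ENNReal.ofReal (T * (δ / (T + 1))) := by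
        rw [Finset.sum_const, Finset.card_range, nsmul_eq_mul,
          ENNReal.ofReal_mul (by positivity), ENNReal.ofReal_natCast]
    _ ≤ _ := by
        refine ENNReal.ofReal_le_ofReal ?_
        rw [← mul_div_assoc, div_le_iff₀ (by positivity)]
        nlinarith

theorem IsCourtProcess.measure_cost_gt_le [IsProbabilityMeasure μ]
    (h : IsCourtProcess μ σ P ℱ x η c)
    (hy : ∀ t, Measurable[ℱ (t + 1)] (y t)) (a₁ a₂ : ℝ) {cmax c₀ : ℝ}
    (hP : ∀ᵐ z ∂P, 0 ≤ z ∧ z ≤ cmax) (hc₀ : c₀ = ∫ z, z ∂P) {δ : ℝ} (hδ : 0 < δ) :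
    μ {ω | ∃ t, 2 * c₀ * kwikCount a₁ a₂ (x · ω) (y · ω) t + cmax * Real.log (1 / δ) <
      kwikCost a₁ a₂ (x · ω) (y · ω) (c · ω) t} ≤ ENNReal.ofReal δ := by
  classical
  have hcm : ∀ t, Measurable (c t) := fun t => (h.cost_measurable t).mono (ℱ.le _) le_rfl
  have hprob : IsProbabilityMeasure P := by
    rw [← h.cost_law 0]; exact Measure.isProbabilityMeasure_map (hcm 0).aemeasurable
  obtain ⟨z, hz0, hz1⟩ := hP.exists
  -- The exponent is scaled by cmax, so cmax = 0, where all costs vanish almost surely, is separate.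
  rcases (hz0.trans hz1).eq_or_lt with hmax | hmax
  · have hc0 : c₀ = 0 := by
      rw [hc₀, integral_eq_zero_of_ae]
      filter_upwards [hP] with z hz
      exact le_antisymm (hz.2.trans hmax.symm.le) hz.1
    have hae : ∀ᵐ ω ∂μ, ∀ t, c t ω = 0 := by
      refine ae_all_iff.2 fun t => ?_
      have := hP
      rw [← h.cost_law t] at this
      filter_upwards [ae_of_ae_map (hcm t).aemeasurable this] with ω hω
      exact le_antisymm (hω.2.trans hmax.symm.le) hω.1
    refine le_of_eq_of_le ?_ zero_le
    refine measure_mono_null ?_ hae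
    rintro ω ⟨t, ht⟩ hω
    rw [hc0, ← hmax, kwikCost, Finset.sum_eq_zero fun t _ => hω t] at ht
    simp at ht
  · have hS := measurableSet_kwikSends a₁ a₂ h.case_measurable hy
    refine le_trans (measure_mono ?_) (measure_exists_exp_ge_le (μ := μ) (ℱ := ℱ)
      (L := fun t ω => (kwikCost a₁ a₂ (x · ω) (y · ω) (c · ω) t -
        2 * c₀ * kwikCount a₁ a₂ (x · ω) (y · ω) t) / cmax)
      (fun t => ?_) (fun ω => by simp [kwikCost, kwikCount])
      (Z := fun t ω => if KwikSends a₁ a₂ (x · ω) (y · ω) t then (1 : ℝ) else 0)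
      (fun t => Measurable.ite (hS t) measurable_const measurable_const) (ξ := c) hcm h.cost_indep
      (k := fun z e => if z = 1 then (e - 2 * c₀) / cmax else 0)
      ?_ (fun t z => ?_) (fun t ω => ?_) hδ)
    · rintro ω ⟨t, ht⟩
      refine ⟨t, ?_⟩
      rw [le_div_iff₀ hmax]
      linarith
    · induction t with
      | zero => simp only [kwikCost, kwikCount, Finset.range_zero, Finset.filter_empty, Finset.sum_empty]; exact measurable_const
      | succ t ih =>
        have hle : ℱ t ≤ ℱ (t + 1) := ℱ.mono t.le_succ
        have h2 : Measurable[ℱ (t + 1)] fun ω => if KwikSends a₁ a₂ (x · ω) (y · ω) t then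
            (c t ω - 2 * c₀) / cmax else 0 :=
          Measurable.ite (hle _ (hS t))
            (((h.cost_measurable t).sub_const (2 * c₀)).div_const cmax) measurable_const
        have h1 := (ih.mono hle le_rfl).add h2
        convert h1 using 2 with ω
        rw [kwikCount_succ, kwikCost_succ]
        simp only [Pi.add_apply]
        split_ifs
        · push_cast; ring
        · push_cast; ring
    · exact Measurable.ite (measurable_fst (measurableSet_singleton 1))
        ((measurable_snd.sub_const _).div_const _) measurable_const
    · rw [h.cost_law t]
      split_ifs
      · exact lintegral_exp_cost_le hmax hP hc₀
      · simp
    · rw [kwikCount_succ, kwikCost_succ]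
      by_cases hs : KwikSends a₁ a₂ (x · ω) (y · ω) t
      · simp only [if_pos hs, if_true]; push_cast; ring
      · simp [if_neg hs]

end Events

/-! ### Numerical inequalities -/

section Numerics

/-- The resolution of the inequality bounding the number of cases in terms of its logarithm. -/
theorem log_det_le_of_potential {n K E ε a m l : ℝ} (hn : 1 ≤ n) (hK : 8 ≤ K) (hε : 0 < ε)
    (hε3 : ε < 3) (hnε : n / ε ≤ E) (hnE : n ≤ 3 * E) (hE : 1 ≤ E)
    (ha : a ^ 2 = ε ^ 2 / (K ^ 2 * (n * (1 + Real.log E)))) (hm : 0 ≤ m) (hl : 0 ≤ l)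
    (h1 : m * Real.log (1 + a ^ 2 / 2) ≤ l) (h2 : l ≤ (n + 1) * Real.log (n + 1 + 2 * m)) :
    l ≤ (16 + 8 * K) * (n * (1 + Real.log E)) ∧
      m ≤ 4 * l * K ^ 2 * (n * (1 + Real.log E)) / ε ^ 2 := by
  set Λ := 1 + Real.log E with hΛ
  have hlogE : 0 ≤ Real.log E := Real.log_nonneg hE
  have hΛ1 : 1 ≤ Λ := by linarith
  have hΛE : Λ ≤ E := by linarith [Real.log_le_sub_one_of_pos (by linarith : 0 < E)]
  have hnΛ : 1 ≤ n * Λ := one_le_mul_of_one_le_of_one_le hn hΛ1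
  have ha0 : 0 < a ^ 2 := by rw [ha]; positivity
  have ha1 : a ^ 2 ≤ 1 := by
    rw [ha, div_le_one (by positivity)]
    nlinarith
  have hm1 : m ≤ 4 * l * K ^ 2 * (n * Λ) / ε ^ 2 := by
    have h3 := Real.le_log_one_add_of_nonneg (by positivity : 0 ≤ a ^ 2 / 2)
    have h4 : a ^ 2 / 4 ≤ 2 * (a ^ 2 / 2) / (a ^ 2 / 2 + 2) := by
      rw [le_div_iff₀ (by positivity)]
      nlinarith
    have h5 : m * (a ^ 2 / 4) ≤ l := (mul_le_mul_of_nonneg_left (h4.trans h3) hm).trans h1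
    have h6 : m ≤ 4 * l / a ^ 2 := by
      rw [le_div_iff₀ ha0]; linarith
    rw [ha] at h6
    refine h6.trans_eq ?_
    field_simp
  refine ⟨?_, hm1⟩
  -- Now q ≤ log(n + 1 + 2m) while m is at most q times powers of K and E. Since log q ≤ q/2, half
  -- of q is absorbed and q ≤ 8 + 4K + 6 log E remains.
  set q := l / (n + 1) with hq
  have hlq : l = q * (n + 1) := by rw [hq]; field_simp
  have hq0 : 0 ≤ q := by positivity
  suffices hq2 : q ≤ (8 + 4 * K) * Λ by
    calc l = q * (n + 1) := hlq
      _ ≤ ((8 + 4 * K) * Λ) * (2 * n) := by gcongr; linarith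
      _ = _ := by ring
  by_cases hq1 : q ≤ 1
  · nlinarith
  push Not at hq1
  have hqlog : q ≤ Real.log (n + 1 + 2 * m) := by
    rw [hq, div_le_iff₀ (by positivity)]; linarith
  have hE3 : E ≤ E ^ 3 := le_self_pow₀ hE (by norm_num)
  have hm2 : m ≤ 8 * q * K ^ 2 * E ^ 3 := by
    calc m ≤ 4 * (q * (n + 1)) * K ^ 2 * (n * Λ) / ε ^ 2 := by rw [← hlq]; exact hm1
      _ ≤ 4 * (q * (2 * n)) * K ^ 2 * (n * E) / ε ^ 2 := by gcongr; linarith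
      _ = 8 * q * K ^ 2 * E * (n / ε) ^ 2 := by field_simp; ring
      _ ≤ 8 * q * K ^ 2 * E * E ^ 2 := by gcongr
      _ = _ := by ring
  have hbig : n + 1 + 2 * m ≤ 22 * q * K ^ 2 * E ^ 3 := by
    have h3 : 1 ≤ q * K ^ 2 := by nlinarith
    have h4 : E ^ 3 ≤ q * K ^ 2 * E ^ 3 := le_mul_of_one_le_left (by positivity) h3
    nlinarith
  have h5 := hqlog.trans (Real.log_le_log (by positivity) hbig)
  have hq' : 0 < q := by linarith
  rw [Real.log_mul (by positivity) (by positivity), Real.log_mul (by positivity) (by positivity),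
    Real.log_mul (by positivity) (by positivity), Real.log_pow, Real.log_pow] at h5
  push_cast at h5
  have h6 : Real.log 22 ≤ 4 := by
    have : Real.log 22 ≤ Real.log (2 ^ 5) := Real.log_le_log (by norm_num) (by norm_num)
    rw [Real.log_pow] at this
    push_cast at this
    linarith [Real.log_two_lt_d9]
  have h7 : Real.log q ≤ q / 2 := by
    have h8 := Real.log_le_sub_one_of_pos (by positivity : 0 < q / 2)
    rw [Real.log_div hq'.ne' (by norm_num)] at h8
    linarith [Real.log_two_lt_d9]
  have h8 : Real.log K ≤ K := by linarith [Real.log_le_sub_one_of_pos (by linarith : 0 < K)]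
  nlinarith

/-- Both summands are at most K√N/4, so a cancels K√N. The target is ε/2 because the comparison with
the court adds two such errors. -/
theorem mul_sqrt_add_two_le {K N ε a R : ℝ} (hN : 1 ≤ N) (hK : 8 ≤ K) (hε : 0 < ε)
    (ha : a = ε / (K * √N)) (hR : R + 1 ≤ K ^ 2 * N / 64) :
    a * (√(4 * R + 4) + 2) ≤ ε / 2 := by
  have hs : 1 ≤ √N := Real.one_le_sqrt.2 hN
  have h1 : √(4 * R + 4) ≤ K * √N / 4 := by
    refine Real.sqrt_le_iff.2 ⟨by positivity, ?_⟩
    rw [div_pow, mul_pow, Real.sq_sqrt (by linarith)]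
    linarith
  have h2 : 2 ≤ K * √N / 4 := by nlinarith
  have ha0 : 0 ≤ a := by rw [ha]; positivity
  calc a * (√(4 * R + 4) + 2) ≤ a * (K * √N / 4 + K * √N / 4) := by gcongr
    _ = ε / 2 := by rw [ha]; field_simp; ring

theorem log_le_three_mul_logFactor {n T : ℕ} {ε δ : ℝ} (hn : 1 ≤ n) (hε : 0 < ε) (hε3 : ε < 3)
    (hδ : 0 < δ) : Real.log (6 * (T + 1) / δ) ≤ 3 * logFactor n T ε δ := by
  have hn' : (1 : ℝ) ≤ n := by exact_mod_cast hn
  have hE : 0 ≤ n * (T + 1) / (ε * δ) := by positivity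
  have h1 : 6 * (T + 1) / δ ≤ 18 * (1 + n * (T + 1) / (ε * δ)) := by
    have h2 : (T + 1) / δ * (1 / 3) ≤ (T + 1) / δ * (n / ε) := by
      gcongr
    have h3 : (T + 1) / δ * (n / ε) = n * (T + 1) / (ε * δ) := by field_simp
    have h4 : 6 * (T + 1) / δ = 6 * ((T + 1) / δ) := by ring
    rw [h3] at h2
    rw [h4]
    linarith
  have h5 := Real.log_le_log (by positivity) h1
  rw [Real.log_mul (by norm_num) (by positivity)] at h5
  have h6 : Real.log 18 ≤ 3 := by
    rw [Real.log_le_iff_le_exp (by norm_num), show (3 : ℝ) = 1 + 1 + 1 by norm_num, Real.exp_add,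
      Real.exp_add]
    have := Real.exp_one_gt_d9
    nlinarith [mul_self_nonneg (Real.exp 1), sq_nonneg (Real.exp 1 - 2.7)]
  have h7 : 0 ≤ Real.log (1 + n * (T + 1) / (ε * δ)) := Real.log_nonneg (by linarith)
  rw [logFactor]
  linarith

end Numerics

end Guarantees

/-! ### Choice of constants and assembly -/

set_option maxHeartbeats 1000000 in
theorem mainTheorem6 :
    ∃ k : ℕ, ∀ σ : NNReal, ∃ C : ℝ, 0 < C ∧
      ∀ (n T : ℕ) (ε δ : ℝ), 1 ≤ n → 0 < ε → 0 < δ → δ < 1 →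
      ∃ a₁ a₂ : ℝ, 0 < a₁ ∧ 0 < a₂ ∧
      ∀ (L : Dataset n → EuclideanSpace ℝ (Fin (n + 1))),
        (∀ D, IsConstrainedLeastSquares D (L D)) →
      ∀ (Ω : Type*) (mΩ : MeasurableSpace Ω) (μ : Measure Ω), IsProbabilityMeasure μ →
      ∀ (ℱ : Filtration ℕ mΩ) (P : Measure ℝ) (cmin cmax c₀ : ℝ)
        (x : ℕ → Ω → EuclideanSpace ℝ (Fin n)) (η c y : ℕ → Ω → ℝ)
        (β : EuclideanSpace ℝ (Fin (n + 1))),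
        IsCourtProcess μ σ P ℱ x η c →
        0 ≤ cmin → (∀ᵐ z ∂P, cmin ≤ z ∧ z ≤ cmax) → c₀ = ∫ z, z ∂P →
        ‖β‖ ≤ 1 → (∀ t ω, y t ω = linearRule β (x t ω) + η t ω) →
        μ {ω | ¬ (
          (∀ t, ¬ KwikSends a₁ a₂ (x · ω) (y · ω) t →
            |linearRule (L (kwikData a₁ a₂ (x · ω) (y · ω) t)) (x t ω) -
              linearRule β (x t ω)| ≤ ε) ∧
          (∀ t < T, ¬ KwikSends a₁ a₂ (x · ω) (y · ω) t →
            |linearRule (L (kwikData a₁ a₂ (x · ω) (y · ω) t)) (x t ω) -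
              linearRule (L (kwikData a₁ a₂ (x · ω) (y · ω) t ++ [(x t ω, y t ω)]))
                (x t ω)| ≤ ε) ∧
          (∀ N, (kwikCount a₁ a₂ (x · ω) (y · ω) N : ℝ) ≤
            C * logFactor n T ε δ ^ k * (n ^ 3 / ε ^ 4)) ∧
          (∀ N, kwikCost a₁ a₂ (x · ω) (y · ω) (c · ω) N ≤
            C * logFactor n T ε δ ^ k *
              (c₀ * (n ^ 3 / ε ^ 4) + cmax)))}
          ≤ ENNReal.ofReal δ := by
  refine ⟨2, fun σ => ?_⟩
  have hr := varianceProxy_pos σ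
  set r := varianceProxy σ with hrdef
  -- Chosen so that K² ≥ 64(r(34 + 8K) + 1), even though K enters the bound on the score through log
  -- det. Here 34 = 16 + 6 + 12, from log det, the confidence term and the extra squared noise.
  set K : ℝ := 512 * r + 64 * (34 * r + 1) + 8 with hKdef
  have hK8 : 8 ≤ K := by rw [hKdef]; nlinarith
  have hKr : 64 * (r * (34 + 8 * K) + 1) ≤ K ^ 2 := by nlinarith
  -- The count bound has constant 36(16 + 8K)K², doubled by the factor 2c₀ in the cost; the 3 pays
  -- for cmax log(3/δ).
  refine ⟨72 * (16 + 8 * K) * K ^ 2 + 3, by positivity, fun n T ε δ hn hε hδ hδ1 => ?_⟩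
  have hn' : (1 : ℝ) ≤ n := by exact_mod_cast hn
  set E : ℝ := 1 + n * (T + 1) / (ε * δ) with hEdef
  have hq0 : 0 ≤ n * (T + 1) / (ε * δ) := by positivity
  have hE1 : 1 ≤ E := by linarith
  have hlogE : 0 ≤ Real.log E := Real.log_nonneg hE1
  have hΛdef : logFactor n T ε δ = 1 + Real.log E := rfl
  have hlog3 := fun hε3 => log_le_three_mul_logFactor (T := T) hn hε hε3 hδ
  set Λ := logFactor n T ε δ with hΛ
  have hΛ1 : 1 ≤ Λ := by rw [hΛdef]; linarith
  by_cases hε3 : 3 ≤ ε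
  · classical
    -- With no data q̄ is zero and ‖ū‖ ≤ √2, so these thresholds never send a case, and any two
    -- rules of norm at most 1 differ by at most 3 ≤ ε.
    refine ⟨1, 2, one_pos, two_pos, ?_⟩
    intro L hL Ω mΩ μ hμ ℱ P cmin cmax c₀ x η c y β hproc hcmin hP hc₀ hβ hy
    refine le_of_eq_of_le ?_ zero_le
    have hcm : Measurable (c 0) := (hproc.cost_measurable 0).mono (ℱ.le _) le_rfl
    have hprob : IsProbabilityMeasure P := by
      rw [← hproc.cost_law 0]; exact Measure.isProbabilityMeasure_map hcm.aemeasurable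
    obtain ⟨z, hz⟩ := hP.exists
    have hcmax : 0 ≤ cmax := by linarith
    have hc0 : 0 ≤ c₀ := by
      rw [hc₀]; exact integral_nonneg_of_ae (hP.mono fun z hz => hcmin.trans hz.1)
    refine measure_mono_null (t := ∅) (fun ω hω => absurd ?_ hω) measure_empty
    have hx := fun t => hproc.case_norm_le t ω
    have hns := not_kwikSends hx (y · ω)
    refine ⟨fun t _ => ?_, fun t _ _ => ?_, fun N => ?_, fun N => ?_⟩
    · exact (abs_linearRule_sub_le_three (hL _).1 hβ (hx t)).trans hε3
    · exact (abs_linearRule_sub_le_three (hL _).1 (hL _).1 (hx t)).trans hε3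
    · rw [kwikCount, Finset.filter_false_of_mem fun t _ => hns t]
      simp only [Finset.card_empty, Nat.cast_zero]
      positivity
    · rw [kwikCost, Finset.filter_false_of_mem fun t _ => hns t, Finset.sum_empty]
      positivity
  push Not at hε3
  replace hlog3 := hlog3 hε3
  have hnΛ : 1 ≤ n * Λ := one_le_mul_of_one_le_of_one_le hn' hΛ1
  have hT : (0 : ℝ) ≤ T := Nat.cast_nonneg T
  have hnε : n / ε ≤ E := by
    have h1 : n * (T + 1) / (ε * δ) = n / ε * ((T + 1) / δ) := by field_simp
    have h2 : 1 ≤ ((T : ℝ) + 1) / δ := by rw [le_div_iff₀ hδ]; linarith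
    have h3 : n / ε ≤ n / ε * (((T : ℝ) + 1) / δ) := le_mul_of_one_le_right (by positivity) h2
    rw [hEdef, h1]; linarith
  have hnE : n ≤ 3 * E := by
    rw [div_le_iff₀ hε] at hnε
    nlinarith
  set a : ℝ := ε / (K * √(n * Λ)) with hadef
  have hapos : 0 < a := by
    have : 0 < √(n * Λ) := Real.sqrt_pos.2 (by linarith)
    positivity
  have hasq : a ^ 2 = ε ^ 2 / (K ^ 2 * (n * (1 + Real.log E))) := by
    rw [hadef, div_pow, mul_pow, Real.sq_sqrt (by linarith), hΛdef]
  have hlogδ : Real.log (1 / (δ / 3)) ≤ Real.log (6 * (T + 1) / δ) := by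
    refine Real.log_le_log (by positivity) ?_
    rw [one_div_div]
    gcongr
    linarith
  refine ⟨a, a, hapos, hapos, ?_⟩
  intro L hL Ω mΩ μ hμ ℱ P cmin cmax c₀ x η c y β hproc hcmin hP hc₀ hβ hy
  have hcm : Measurable (c 0) := (hproc.cost_measurable 0).mono (ℱ.le _) le_rfl
  have hprob : IsProbabilityMeasure P := by
    rw [← hproc.cost_law 0]; exact Measure.isProbabilityMeasure_map hcm.aemeasurable
  have hP0 : ∀ᵐ z ∂P, 0 ≤ z ∧ z ≤ cmax := hP.mono fun z hz => ⟨hcmin.trans hz.1, hz.2⟩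
  obtain ⟨z, hz⟩ := hP0.exists
  have hcmax : 0 ≤ cmax := hz.1.trans hz.2
  have hc0 : 0 ≤ c₀ := by
    rw [hc₀]; exact integral_nonneg_of_ae (hP0.mono fun z hz => hz.1)
  have hδ3 : 0 < δ / 3 := by positivity
  have e1 := hproc.measure_scoreNormSq_ge_le hy a a hδ3
  have e2 := hproc.measure_noise_sq_ge_le T hδ3
  have e3 := hproc.measure_cost_gt_le (hproc.measurable_observation hy) a a hP0 hc₀ hδ3
  have hunion := (measure_union_le _ _).trans
    (add_le_add ((measure_union_le _ _).trans (add_le_add e1 e2)) e3)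
  rw [← ENNReal.ofReal_add hδ3.le hδ3.le, ← ENNReal.ofReal_add (by positivity) hδ3.le,
    show δ / 3 + δ / 3 + δ / 3 = δ by ring] at hunion
  refine (measure_mono fun ω hω => ?_).trans hunion
  by_contra hgood
  refine hω ?_
  simp only [Set.mem_union, Set.mem_ofPred_eq, not_or, not_exists, not_le, not_lt, not_and,
    ← hrdef] at hgood
  obtain ⟨⟨g1, g2⟩, g3⟩ := hgood
  rw [show 2 * ((T : ℝ) + 1) / (δ / 3) = 6 * (T + 1) / δ by field_simp; ring] at g2
  have hx := fun t => hproc.case_norm_le t ω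
  have hdet : ∀ t, Real.log (ridge (kwikData a a (x · ω) (y · ω) t)).det ≤
        (16 + 8 * K) * (n * Λ) ∧
      (kwikCount a a (x · ω) (y · ω) t : ℝ) ≤
        4 * Real.log (ridge (kwikData a a (x · ω) (y · ω) t)).det * K ^ 2 * (n * Λ) / ε ^ 2 := by
    intro t
    have h1 := kwikCount_mul_log_le (x := (x · ω)) (y := (y · ω)) hapos.le t
    have h2 := log_det_ridge_le _ (norm_le_of_mem_kwikData (a₁ := a) (a₂ := a) (y := (y · ω)) hx t)
    rw [length_kwikData] at h2
    exact log_det_le_of_potential hn' hK8 hε hε3 hnε hnE hE1 hasq (Nat.cast_nonneg _)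
      (Real.log_nonneg (one_le_det_ridge _)) h1 h2
  have hscore : ∀ t e, e ^ 2 ≤ 4 * r * Real.log (6 * (T + 1) / δ) →
      scoreNormSq β (kwikData a a (x · ω) (y · ω) t) + e ^ 2 + 1 ≤ K ^ 2 * (n * Λ) / 64 := by
    intro t e he
    have h1 := g1 t
    have h2 : scoreNormSq β (kwikData a a (x · ω) (y · ω) t) ≤
        r * Real.log (ridge (kwikData a a (x · ω) (y · ω) t)).det +
          2 * r * Real.log (1 / (δ / 3)) := by
      have h3 : scoreNormSq β (kwikData a a (x · ω) (y · ω) t) / (2 * r) ≤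
          Real.log (1 / (δ / 3)) +
            Real.log (ridge (kwikData a a (x · ω) (y · ω) t)).det / 2 := by linarith
      rw [div_le_iff₀ (by positivity)] at h3
      linarith
    have h4 := mul_le_mul_of_nonneg_left (hdet t).1 hr.le
    have h5 := mul_le_mul_of_nonneg_left (hlogδ.trans hlog3) hr.le
    have h6 := mul_le_mul_of_nonneg_left hlog3 hr.le
    have h7 : r * Λ ≤ r * (n * Λ) :=
      mul_le_mul_of_nonneg_left (le_mul_of_one_le_left (by linarith) hn') hr.le
    have h8 := mul_le_mul_of_nonneg_right hKr (by linarith : 0 ≤ n * Λ)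
    linarith
  have hcount : ∀ t, (kwikCount a a (x · ω) (y · ω) t : ℝ) ≤
      36 * (16 + 8 * K) * K ^ 2 * Λ ^ 2 * (n ^ 3 / ε ^ 4) := by
    intro t
    have h1 : (n : ℝ) ^ 2 / ε ^ 2 ≤ 9 * (n ^ 3 / ε ^ 4) := by
      rw [← mul_div_assoc, div_le_div_iff₀ (by positivity) (by positivity)]
      have h2 : (n : ℝ) ^ 2 ≤ n ^ 3 := pow_le_pow_right₀ hn' (by norm_num)
      have h3 : ε ^ 4 ≤ 9 * ε ^ 2 := by
        have h4 : ε ^ 2 ≤ 9 := by nlinarith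
        nlinarith [mul_nonneg (sq_nonneg ε) (sub_nonneg.2 h4)]
      calc (n : ℝ) ^ 2 * ε ^ 4 ≤ n ^ 3 * (9 * ε ^ 2) := by gcongr
        _ = _ := by ring
    calc (kwikCount a a (x · ω) (y · ω) t : ℝ)
        ≤ 4 * Real.log (ridge (kwikData a a (x · ω) (y · ω) t)).det * K ^ 2 * (n * Λ) / ε ^ 2 :=
          (hdet t).2
      _ ≤ 4 * ((16 + 8 * K) * (n * Λ)) * K ^ 2 * (n * Λ) / ε ^ 2 := by
          gcongr; exact (hdet t).1
      _ = 4 * (16 + 8 * K) * K ^ 2 * Λ ^ 2 * (n ^ 2 / ε ^ 2) := by ring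
      _ ≤ 4 * (16 + 8 * K) * K ^ 2 * Λ ^ 2 * (9 * (n ^ 3 / ε ^ 4)) := by gcongr
      _ = _ := by ring
  have herror : ∀ t, ¬ KwikSends a a (x · ω) (y · ω) t →
      |linearRule (L (kwikData a a (x · ω) (y · ω) t)) (x t ω) - linearRule β (x t ω)| ≤
        ε / 2 := by
    intro t ht
    refine ((hL _).abs_sub_le ht hβ).trans ?_
    have hlog0 : 0 ≤ Real.log (6 * (T + 1) / δ) := by
      refine Real.log_nonneg ?_
      rw [le_div_iff₀ hδ]
      linarith
    -- With e = 0 no bound on the current noise is used, so the estimate holds for all t and not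
    -- only for t < T.
    have h1 := hscore t 0 (by rw [zero_pow two_ne_zero]; exact mul_nonneg (by positivity) hlog0)
    exact mul_sqrt_add_two_le hnΛ hK8 hε hadef (by linarith)
  refine ⟨fun t ht => (herror t ht).trans (by linarith), fun t htT ht => ?_, fun N => ?_,
    fun N => ?_⟩
  · have h1 := (hL _).abs_sub_le_of_append (y := y t ω) ht hβ
    have h2 := hscore t _ (g2 t htT).le
    have h3 := h1.trans (mul_sqrt_add_two_le hnΛ hK8 hε hadef (by
      rw [show y t ω - linearRule β (x t ω) = η t ω by rw [hy]; ring]; exact h2))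
    rw [abs_sub_comm] at h3
    have h4 := abs_sub_le (linearRule (L (kwikData a a (x · ω) (y · ω) t)) (x t ω))
      (linearRule β (x t ω))
      (linearRule (L (kwikData a a (x · ω) (y · ω) t ++ [(x t ω, y t ω)])) (x t ω))
    linarith [herror t ht]
  · refine (hcount N).trans ?_
    gcongr
    nlinarith [show 0 ≤ (16 + 8 * K) * K ^ 2 by positivity]
  · have h1 : cmax * Real.log (1 / (δ / 3)) ≤ cmax * (3 * Λ ^ 2) := by
      refine mul_le_mul_of_nonneg_left ((hlogδ.trans hlog3).trans ?_) hcmax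
      nlinarith
    have h2 := mul_le_mul_of_nonneg_left (hcount N) (by positivity : 0 ≤ 2 * c₀)
    have h3 : 0 ≤ 3 * Λ ^ 2 * (c₀ * (n ^ 3 / ε ^ 4)) := by positivity
    have h4 : 0 ≤ 72 * (16 + 8 * K) * K ^ 2 * Λ ^ 2 * cmax := by positivity
    linarith [g3 N]
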